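/- \textbf{Setting.} Let $K$ be a finite cactus (a connected simple graph in which any two different cycles have at most one common vertex), $w:V(K)\to(0,\infty)$ a weight function and $r\in V(K)$. A set $D$ is dominating in a graph $G$ if every vertex of $G$ lies in $D$ or has a neighbour in $D$; $w(D)=\sum_{v\in D}w(v)$. Put $\gamma_w(G)=\min\{w(D): D \text{ dominating}\}$, $\gamma_w^{00}(G,v)=\gamma_w(G-v)$, $\gamma_w^{1}(G,v)=\min\{w(D): D\text{ dominating in }G,\ v\in D\}$, $\gamma_w^{0}(G,v)=\min\{w(D): D\text{ dominating in }G,\ v\notin D\}$, with $\min\emptyset=\infty$. \textbf{Input.} A DFS data structure of $(K,r)$ is given by an arbitrary depth first search of $K$ from $r$: $\mathrm{DFN}(v)$ is the position of $v$ in the order of first visits ($\mathrm{DFN}(r)=0$); $\mathrm{FATHER}(v)$ is the father of $v$ in the DFS tree ($\mathrm{FATHER}(r)=r$); if $v$ lies on a cycle of which it is not the first vertex in the DFS order, then $\mathrm{ROOT}(v)$ is the first vertex of that cycle and $\mathrm{ORIEN}(v)$ is the son of $\mathrm{ROOT}(v)$ visited first on that cycle; otherwise $\mathrm{ROOT}(v)=\mathrm{ORIEN}(v)=v$.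 \textbf{Algorithm CACTUS.} Each vertex $v$ stores values $\gamma^{00}(v),\gamma^1(v),\gamma^0(v),\gamma(v)$, initially $0,w(v),\infty,w(v)$, set once at the start and not again in recursive calls; all vertices are initially unread. A call has as input a table of consecutive vertices in the DFS order whose first vertex is its root $\rho$ (at the outset: all vertices, $\rho=r$). While the last unread vertex $\mathrm{Last}$ of the table is not $\rho$: (a) If $\mathrm{ROOT}(\mathrm{Last})=\mathrm{Last}$: put $v=\mathrm{Last}$ and repeat: $u=\mathrm{FATHER}(v)$; if $\mathrm{ROOT}(u)=u$ and $\mathrm{DFN}(u)<\mathrm{DFN}(v)-1$, call CACTUS on the vertices with $\mathrm{DFN}=\mathrm{DFN}(u),\dots,\mathrm{DFN}(v)-1$ and root $u$; then simultaneously (\emph{edge join}) $\gamma^{00}(u):=\gamma^{00}(u)+\gamma(v)$, $\gamma^1(u):=\gamma^1(u)+\min\{\gamma^1(v),\gamma^{00}(v)\}$, $\gamma^0(u):=\min\{\gamma^0(u)+\gamma(v),\gamma^{00}(u)+\gamma^1(v)\}$, and $\gamma(u)$ becomes the minimum of the new $\gamma^1(u),\gamma^0(u)$; mark $v$ read; $v:=u$;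 until $\mathrm{ROOT}(v)\neq v$ or $v=\rho$. (b) Otherwise: put $v=\mathrm{Last}$ and repeat: $u=\mathrm{FATHER}(v)$; if $\mathrm{DFN}(u)<\mathrm{DFN}(v)-1$, call CACTUS on the vertices with $\mathrm{DFN}=\mathrm{DFN}(u),\dots,\mathrm{DFN}(v)-1$ and root $u$; $v:=u$; until $v=\mathrm{ORIEN}(v)$. Let $s$ be the final $v$, $c=\mathrm{FATHER}(s)$ the root of the cycle and $p_1=\mathrm{Last},p_2=\mathrm{FATHER}(p_1),\dots,p_m=s$ the vertices passed. Let CYCLE-LIKE return $\gamma^{*}(C)$ ($*=00,1,0$) for the cycle $c,p_m,\dots,p_1$, using the stored values of the $p_i$ and the single-vertex values $0,w(c),\infty,w(c)$ for $c$. Then simultaneously (\emph{gluing}) $\gamma^{00}(c):=\gamma^{00}(c)+\gamma^{00}(C)$, $\gamma^1(c):=\gamma^1(c)+\gamma^1(C)-w(c)$, $\gamma^0(c):=\min\{\gamma^0(c)+\gamma^{00}(C),\gamma^{00}(c)+\gamma^0(C)\}$, and $\gamma(c)$ becomes the minimum of the new $\gamma^1(c),\gamma^0(c)$; mark $p_1,\dots,p_m$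 read. \textbf{Subalgorithms} (they work on copies of the values). PATH-LIKE on a path $p_1,\dots,p_m$ performs the edge joins of $p_1$ to $p_2$, then of $p_2$ to $p_3$, ..., and returns the resulting values of $p_m$. D-CLOSED PATH-LIKE does the same, except that the first join is replaced by $\gamma^{00}(p_2):=\gamma^{00}(p_2)+\gamma^1(p_1)$, $\gamma^1(p_2):=\gamma^1(p_2)+\gamma^1(p_1)$, $\gamma^0(p_2):=\gamma^{00}(p_2)+\gamma^1(p_1)$ (old values on the right), $\gamma(p_2)$ being the minimum of the new $\gamma^1(p_2),\gamma^0(p_2)$. CYCLE-LIKE on the cycle $c,p_m,\dots,p_1$ returns: $\gamma^{00}(C)=$ the value $\gamma$ of PATH-LIKE on $p_1,\dots,p_m$; $\gamma^1(C)=$ the value $\gamma^1$ of D-CLOSED PATH-LIKE on $c',p_1,\dots,p_m,c$, where $c'$ is a copy of $c$, minus $w(c)$; $\gamma^0(C)=$ the minimum of the value $\gamma^1$ of PATH-LIKE on $p_1,\dots,p_m$ and the value $\gamma$ of D-CLOSED PATH-LIKE on $p_1,\dots,p_m$; and $\gamma(C)=\min\{\gamma^1(C),\gamma^0(C)\}$.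 \textbf{Proposition.} For every finite cactus $K$, all positive weights $w$, every root $r$ and every DFS data structure of $(K,r)$, algorithm CACTUS terminates, and at the end the values stored at $r$ are $$\gamma(r)=\gamma_w(K),\quad \gamma^{00}(r)=\gamma_w^{00}(K,r),\quad \gamma^{1}(r)=\gamma_w^{1}(K,r),\quad \gamma^{0}(r)=\gamma_w^{0}(K,r).$$ -/

import Mathlib

namespace CactusDomination

/-! ### Weighted domination -/

/-- `N[D] = V`: every vertex lies in `D` or is adjacent to a vertex of `D`. -/
def IsDominating {V : Type*} (G : SimpleGraph V) (D : Finset V) : Prop :=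
  ∀ v, ∃ u ∈ D, u = v ∨ G.Adj u v

/-- `w(D)`, the sum of the weights of the vertices in `D`. -/
def weight {V : Type*} (w : V → ℝ) (D : Finset V) : ℝ := ∑ v ∈ D, w v

/-- The weighted domination number `γ_w(G)`. On a finite graph the infimum is over a finite nonempty
set, so it is a minimum. All parameters are extended reals because `γ⁰` may be a minimum over the
empty set, which is `∞`. -/
noncomputable def gammaW {V : Type*} (G : SimpleGraph V) (w : V → ℝ) : EReal :=
  sInf {x : EReal | ∃ D : Finset V, IsDominating G D ∧ x = (weight w D : ℝ)}

/-- `γ_w⁰⁰(G,v) = γ_w(G - v)`. -/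
noncomputable def gamma00 {V : Type*} (G : SimpleGraph V) (w : V → ℝ) (v : V) : EReal :=
  gammaW (G.induce {x | x ≠ v}) (fun x => w x)

/-- `γ_w¹(G,v)`: minimum weight of a dominating set that contains `v`. -/
noncomputable def gamma1 {V : Type*} (G : SimpleGraph V) (w : V → ℝ) (v : V) : EReal :=
  sInf {x : EReal | ∃ D : Finset V, IsDominating G D ∧ v ∈ D ∧ x = (weight w D : ℝ)}

/-- `γ_w⁰(G,v)`: minimum weight of a dominating set that does not contain `v`. -/
noncomputable def gamma0 {V : Type*} (G : SimpleGraph V) (w : V → ℝ) (v : V) : EReal :=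
  sInf {x : EReal | ∃ D : Finset V, IsDominating G D ∧ v ∉ D ∧ x = (weight w D : ℝ)}

/-! ### Cacti -/

/-- A cactus: a connected graph in which two different cycles share at most one vertex. Cycles are
compared as subgraphs, so that base point and direction of traversal do not matter. -/
def IsCactus {V : Type*} (K : SimpleGraph V) : Prop :=
  K.Connected ∧
    ∀ (a b : V) (c : K.Walk a a) (d : K.Walk b b), c.IsCycle → d.IsCycle →
      c.toSubgraph ≠ d.toSubgraph →
        ∀ x y, x ∈ c.support → x ∈ d.support → y ∈ c.support → y ∈ d.support → x = y

/-! ### Depth first search and the DFS data structure -/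

/-- `DFSReach G r v ord f`: some run of depth first search from `r` reaches the situation where `v`
is the current vertex, `ord` lists the visited vertices in the order of their first visits, and `f`
is the array FATHER (initially `FATHER(v) = v` for all `v`). The search may visit the neighbours of
a vertex in any order. -/
inductive DFSReach {V : Type*} [DecidableEq V] (G : SimpleGraph V) (r : V) :
    V → List V → (V → V) → Prop
  | init : DFSReach G r r [r] id
  | visit {v w : V} {ord : List V} {f : V → V} : DFSReach G r v ord f → G.Adj v w → w ∉ ord →
      DFSReach G r w (ord ++ [w]) (Function.update f w v)
  | back {v : V} {ord : List V} {f : V → V} : DFSReach G r v ord f → v ≠ r →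
      (∀ w, G.Adj v w → w ∈ ord) → DFSReach G r (f v) ord f

/-- The DFS table: the DFS order and the arrays FATHER, ROOT, ORIEN. -/
structure DFSTable (V : Type*) where
  order : List V
  father : V → V
  root : V → V
  orien : V → V

/-- `DFN(v)`, the position of `v` in the DFS order, counted from `0`. -/
def DFSTable.dfn {V : Type*} [DecidableEq V] (T : DFSTable V) (v : V) : ℕ := T.order.idxOf v

/-- `x` is the first vertex of the closed walk `c` in the DFS order. -/
def DFSTable.IsFirst {V : Type*} [DecidableEq V] (T : DFSTable V) {K : SimpleGraph V} {a : V}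
    (c : K.Walk a a) (x : V) : Prop :=
  x ∈ c.support ∧ ∀ y ∈ c.support, T.dfn x ≤ T.dfn y

/-- `x` is the son of `ρ` on the closed walk `c` that is visited first. -/
def DFSTable.IsFirstSon {V : Type*} [DecidableEq V] (T : DFSTable V) {K : SimpleGraph V} {a : V}
    (c : K.Walk a a) (ρ x : V) : Prop :=
  (x ∈ c.support ∧ x ≠ ρ ∧ T.father x = ρ) ∧
    ∀ y ∈ c.support, y ≠ ρ → T.father y = ρ → T.dfn x ≤ T.dfn y

/-- `T` is a DFS data structure of `K` with root `r`: the order and FATHER come from a completed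
depth first search from `r`; if `v` lies on a cycle of which it is not the first vertex, then
`ROOT(v)` is the first vertex of that cycle and `ORIEN(v)` the son of `ROOT(v)` visited first on it;
otherwise (no cycle through `v`, or `v` is the first vertex of every cycle through it)
`ROOT(v) = ORIEN(v) = v`. -/
structure DFSTable.IsDFSTableOf {V : Type*} [DecidableEq V] (T : DFSTable V) (K : SimpleGraph V)
    (r : V) : Prop where
  search : DFSReach K r r T.order T.father
  complete : ∀ w, K.Adj r w → w ∈ T.order
  rootOrien : ∀ v,
    (T.root v ≠ v ∧ ∃ (a : V) (c : K.Walk a a), c.IsCycle ∧ v ∈ c.support ∧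
        T.IsFirst c (T.root v) ∧ T.IsFirstSon c (T.root v) (T.orien v)) ∨
      (T.root v = v ∧ T.orien v = v ∧
        ∀ (a : V) (c : K.Walk a a), c.IsCycle → v ∈ c.support → T.IsFirst c v)

/-- The vertices with `DFN = DFN(w), …, DFN(v) - 1`, in the DFS order. -/
def DFSTable.segment {V : Type*} [DecidableEq V] (T : DFSTable V) (w v : V) : List V :=
  (T.order.drop (T.dfn w)).take (T.dfn v - T.dfn w)

/-! ### The recurrences -/

/-- The four values stored at a vertex. -/
structure Params where
  g00 : EReal
  g1 : EReal
  g0 : EReal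
  g : EReal

/-- The values of a single vertex of weight `x`: `γ⁰⁰ = 0`, `γ¹ = x`, `γ⁰ = ∞`, `γ = x`. -/
noncomputable def initParams (x : ℝ) : Params := ⟨0, x, ⊤, x⟩

/-- New values at `w` after joining the graph rooted at `v` to the graph rooted at `w` by the edge
`wv`. The right-hand sides use the old values of `w`. -/
noncomputable def edgeJoin (pw pv : Params) : Params where
  g00 := pw.g00 + pv.g
  g1 := pw.g1 + min pv.g1 pv.g00
  g0 := min (pw.g0 + pv.g) (pw.g00 + pv.g1)
  g := min (pw.g1 + min pv.g1 pv.g00) (min (pw.g0 + pv.g) (pw.g00 + pv.g1))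

/-- The edge join under the condition that `v` belongs to the dominating set. -/
noncomputable def edgeJoinClosed (pw pv : Params) : Params where
  g00 := pw.g00 + pv.g1
  g1 := pw.g1 + pv.g1
  g0 := pw.g00 + pv.g1
  g := min (pw.g1 + pv.g1) (pw.g00 + pv.g1)

/-- New values at the common vertex, of weight `x`, of two graphs that are glued at it. -/
noncomputable def glue (x : ℝ) (p q : Params) : Params where
  g00 := p.g00 + q.g00
  g1 := p.g1 + q.g1 - x
  g0 := min (p.g0 + q.g00) (p.g00 + q.g0)
  g := min (p.g1 + q.g1 - x) (min (p.g0 + q.g00) (p.g00 + q.g0))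

/-! ### The subalgorithms

The values of the vertices of a path are given from the last one in the DFS order (FATHER is the
next entry) to the root of the path, which is the final entry. -/

/-- PATH-LIKE on the path with values `p :: rest`. -/
noncomputable def pathLike (p : Params) (rest : List Params) : Params :=
  rest.foldl (fun pv pw => edgeJoin pw pv) p

/-- D-CLOSED PATH-LIKE on the path with values `p :: q :: rest`; the last vertex in the DFS order,
the one with values `p`, has to be in the dominating set. -/
noncomputable def dClosedPathLike (p q : Params) (rest : List Params) : Params :=
  pathLike (edgeJoinClosed q p) rest

/-- CYCLE-LIKE on a rooted cycle: `pr` are the values of the root `r`, and the list holds the values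
of the other vertices, from the last one in the DFS order to the first one (`s`). There are at least
two of them. The copy `r'` of the root carries the values `pr` as well. -/
noncomputable def cycleLike (pr : Params) : List Params → Option Params
  | p :: q :: rest =>
    -- the path `s, …, v`
    let path := pathLike p (q :: rest)
    -- the path `r, s, …, v, r'` with `r'` in the dominating set
    let closed := dClosedPathLike pr p (q :: rest ++ [pr])
    -- the path `s, …, v` with `v` in the dominating set
    let half := dClosedPathLike p q rest
    some
      { g00 := path.g
        g1 := closed.g1 - pr.g1
        g0 := min path.g1 half.g
        g := min (closed.g1 - pr.g1) (min path.g1 half.g) }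
  | _ => none

/-! ### The algorithm CACTUS

Loops and recursive calls are run with a bound ("fuel") on their number; the value `none` says that
the bound was too small. -/

/-- The four arrays, and the set of vertices that were already read, that is, whose values have been
passed on to the father or to the root of the cycle. -/
structure State (V : Type*) where
  val : V → Params
  read : Finset V

/-- The initial state: the values of single vertices, and no vertex read. -/
noncomputable def initState {V : Type*} (w : V → ℝ) : State V where
  val := fun v => initParams (w v)
  read := ∅

/-- The last unread vertex of a table with root `r` (the root itself if the rest is read). -/
def lastUnread {V : Type*} [DecidableEq V] (tbl : List V) (r : V) (σ : State V) : V :=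
  ((tbl.filter (fun x => x ∉ σ.read)).getLast?).getD r

/-- The edge join of `v` to its father `w`. -/
noncomputable def State.joinEdge {V : Type*} [DecidableEq V] (σ : State V) (w v : V) : State V where
  val := Function.update σ.val w (edgeJoin (σ.val w) (σ.val v))
  read := insert v σ.read

/-- The repeat-until loop of CACTUS for a last vertex that does not lie on a cycle (i.e. it is equal
to its ROOT). `r` is the root of the current subcactus; `call w v` runs CACTUS on the rooted
subcactus with the vertices `DFN(w), …, DFN(v) - 1` and the root `w`. -/
noncomputable def treeLoop {V : Type*} [DecidableEq V] (T : DFSTable V)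
    (call : V → V → State V → Option (State V)) (r : V) : ℕ → V → State V → Option (State V)
  | 0, _, _ => none
  | k + 1, v, σ =>
    let w := T.father v
    (if T.root w = w ∧ T.dfn w < T.dfn v - 1 then call w v σ else some σ).bind fun σ' =>
      if T.root w ≠ w ∨ w = r then some (σ'.joinEdge w v)
      else treeLoop T call r k w (σ'.joinEdge w v)

/-- The repeat-until loop of CACTUS that goes along a cycle from its last vertex `v` to the vertex
`s` with `ORIEN(s) = s` and runs CACTUS on the subcacti rooted at the hinges. It also returns the
vertices of the cycle from `v` to `s`. -/
noncomputable def cycleLoop {V : Type*} [DecidableEq V] (T : DFSTable V)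
    (call : V → V → State V → Option (State V)) :
    ℕ → V → State V → Option (State V × List V)
  | 0, _, _ => none
  | k + 1, v, σ =>
    let w := T.father v
    (if T.dfn w < T.dfn v - 1 then call w v σ else some σ).bind fun σ' =>
      if w = T.orien w then some (σ', [v, w])
      else (cycleLoop T call k w σ').map fun p => (p.1, v :: p.2)

/-- The cycle part of CACTUS: the loop above, then CYCLE-LIKE on the cycle, whose root `ρ` is the
father of the vertex `s` and enters as a single vertex, then the gluing of the result at `ρ`. -/
noncomputable def cycleStep {V : Type*} [DecidableEq V] (T : DFSTable V) (w : V → ℝ)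
    (call : V → V → State V → Option (State V)) (k : ℕ) (last : V) (σ : State V) :
    Option (State V) :=
  (cycleLoop T call k last σ).bind fun (σ', cyc) =>
    let ρ := T.father (cyc.getLast?.getD last)
    (cycleLike (initParams (w ρ)) (cyc.map σ'.val)).map fun q =>
      { val := Function.update σ'.val ρ (glue (w ρ) (σ'.val ρ) q)
        read := σ'.read ∪ cyc.toFinset }

/-- The while loop of CACTUS on the subcactus with vertex list `tbl` and root `r`. The parameter `m`
bounds the inner loops. -/
noncomputable def whileLoop {V : Type*} [DecidableEq V] (T : DFSTable V) (w : V → ℝ)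
    (call : V → V → State V → Option (State V)) (m : ℕ) (tbl : List V) (r : V) :
    ℕ → State V → Option (State V)
  | 0, _ => none
  | k + 1, σ =>
    let last := lastUnread tbl r σ
    if last = r then some σ
    else
      (if T.root last = last then treeLoop T call r m last σ
        else cycleStep T w call m last σ).bind fun σ' =>
          whileLoop T w call m tbl r k σ'

/-- The recursive algorithm CACTUS on the subcactus with vertex list `tbl` and root `r`, where
recursion depth and loops are bounded by the first argument. -/
noncomputable def cactusOn {V : Type*} [DecidableEq V] (T : DFSTable V) (w : V → ℝ) :
    ℕ → List V → V → State V → Option (State V)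
  | 0, _, _, _ => none
  | n + 1, tbl, r, σ =>
    whileLoop T w (fun x v τ => cactusOn T w n (T.segment x v) x τ) (n + 1) tbl r (n + 1) σ

/-- CACTUS on the rooted cactus with DFS table `T` and root `r`: initialize the arrays, run the
algorithm on the whole table, return the values at the root. The result is `none` if the bound `n`
on recursion depth and loops does not suffice. -/
noncomputable def cactus {V : Type*} [DecidableEq V] (T : DFSTable V) (w : V → ℝ) (r : V) (n : ℕ) :
    Option Params :=
  (cactusOn T w n T.order r (initState w)).map fun σ => σ.val r

end CactusDomination

/-!
The values that CACTUS stores at an unread vertex `v` are at every moment the four domination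
parameters, with root `v`, of an induced subgraph of `K`. These subgraphs are the fibres of a map
`rep` that sends each vertex to the unread vertex into which it has been merged, and every edge of
`K` between two fibres connects their representatives (`Sound`). Initially the fibres are single
vertices; when only `r` is unread, the fibre of `r` is all of `V`.

The invariant is preserved for local reasons. An edge join of `v` to `u` is correct if `u` is the only
unread neighbour of `v` (`Sound.joinEdge`), and a cycle may be contracted to its root if no other
vertex of it has an unread neighbour outside the cycle (`Sound.cycle`). That the recurrences compute
the right minima is shown by splitting a dominating set along the pieces (`RootedValues.edgeJoin`,
`RootedValues.glue`, `exists_cycleLike`). The closed variants of PATH-LIKE are ordinary paths in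
which a vertex is prescribed; for the path that begins with a copy of the cycle root, the copy is the
root itself in the graph without the last edge of the cycle.

It remains to see that the algorithm only makes such steps and gets through. In a depth first search
tree every edge joins a vertex to one of its ancestors and the descendants of a vertex are
consecutive (`DFSTree`), and the cycles of a cactus correspond to the back edges, which cover disjoint
sets of tree edges (`Covers.unique`); this determines ROOT and ORIEN
(`DFSTable.IsDFSTableOf.of_covers`). Hence a call works on a table that contains the descendants
of its vertices other than the root and does not cut their cycles (`Region`), and at each pass through the while loop the read vertices of the table
form a final segment of it (`exists_whileLoop`). So all descendants of the vertex at hand are read,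
apart from those on its own cycle, and the final segment grows with each pass. Finally, the
correct values are unique, so the result is the same for all sufficiently large bounds.
-/

namespace CactusDomination

/-! ### Optimal weights -/

/-- The least weight of a set with property `P`, or `∞` if there is no such set. -/
noncomputable def opt {V : Type*} (w : V → ℝ) (P : Finset V → Prop) : EReal :=
  sInf {x : EReal | ∃ D : Finset V, P D ∧ x = (weight w D : ℝ)}

section Opt

variable {V : Type*} {w : V → ℝ} {P Q P₁ P₂ : Finset V → Prop}

lemma opt_congr (h : ∀ D, P D ↔ Q D) : opt w P = opt w Q := by
  rw [show P = Q from funext fun D => propext (h D)]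

lemma opt_anti (h : ∀ D, P D → Q D) : opt w Q ≤ opt w P :=
  sInf_le_sInf fun _ ⟨D, hD, hx⟩ => ⟨D, h D hD, hx⟩

lemma opt_or : opt w (fun D => P D ∨ Q D) = min (opt w P) (opt w Q) := by
  rw [opt, opt, opt, ← sInf_union]
  congr 1
  ext x
  simp only [Set.mem_ofPred_eq, Set.mem_union]
  constructor
  · rintro ⟨D, hD | hD, hx⟩
    exacts [Or.inl ⟨D, hD, hx⟩, Or.inr ⟨D, hD, hx⟩]
  · rintro (⟨D, hD, hx⟩ | ⟨D, hD, hx⟩)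
    exacts [⟨D, Or.inl hD, hx⟩, ⟨D, Or.inr hD, hx⟩]

lemma opt_eq_top (h : ∀ D, ¬ P D) : opt w P = ⊤ := by
  rw [opt, sInf_eq_top]
  rintro a ⟨D, hD, -⟩
  exact absurd hD (h D)

lemma opt_eq_weight {D : Finset V} (hD : P D) (hmin : ∀ D', P D' → weight w D ≤ weight w D') :
    opt w P = (weight w D : ℝ) := by
  refine le_antisymm (sInf_le ⟨D, hD, rfl⟩) (le_sInf ?_)
  rintro _ ⟨D', hD', rfl⟩
  exact_mod_cast hmin D' hD'

lemma exists_minimal_weight [Fintype V] (h : ∃ D, P D) :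
    ∃ D, P D ∧ ∀ D', P D' → weight w D ≤ weight w D' := by
  classical
  obtain ⟨D, hD, hmin⟩ := Finset.exists_min_image (Finset.univ.filter P) (weight w)
    (by obtain ⟨D, hD⟩ := h; exact ⟨D, by simpa using hD⟩)
  exact ⟨D, by simpa using hD, fun D' hD' => hmin D' (by simpa using hD')⟩

/-- If the sets with property `P` correspond to pairs of sets with properties `P₁` and `P₂`, up to
a fixed weight `c` that is counted twice in the pairs, then the optimal weights add up. -/
lemma opt_add_eq [Fintype V] (c : ℝ)
    (h₁ : ∀ D₁ D₂, P₁ D₁ → P₂ D₂ → ∃ D, P D ∧ weight w D + c = weight w D₁ + weight w D₂)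
    (h₂ : ∀ D, P D → ∃ D₁ D₂, P₁ D₁ ∧ P₂ D₂ ∧ weight w D + c = weight w D₁ + weight w D₂) :
    opt w P = opt w P₁ + opt w P₂ - c := by
  by_cases e₁ : ∃ D, P₁ D
  · obtain ⟨D₁, hD₁, m₁⟩ := exists_minimal_weight (w := w) e₁
    by_cases e₂ : ∃ D, P₂ D
    · obtain ⟨D₂, hD₂, m₂⟩ := exists_minimal_weight (w := w) e₂
      obtain ⟨D, hD, hDw⟩ := h₁ D₁ D₂ hD₁ hD₂
      rw [opt_eq_weight hD₁ m₁, opt_eq_weight hD₂ m₂, opt_eq_weight hD]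
      · rw [← EReal.coe_add, ← EReal.coe_sub, ← hDw, add_sub_cancel_right]
      · intro D' hD'
        obtain ⟨E₁, E₂, hE₁, hE₂, hE⟩ := h₂ D' hD'
        linarith [m₁ E₁ hE₁, m₂ E₂ hE₂]
    · rw [opt_eq_weight hD₁ m₁, opt_eq_top (P := P₂) (by simpa using e₂),
        opt_eq_top (P := P), EReal.coe_add_top, EReal.top_sub_coe]
      intro D hD
      obtain ⟨E₁, E₂, -, hE₂, -⟩ := h₂ D hD
      exact e₂ ⟨E₂, hE₂⟩
  · rw [opt_eq_top (P := P₁) (by simpa using e₁), opt_eq_top (P := P)]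
    · by_cases e₂ : ∃ D, P₂ D
      · obtain ⟨D₂, hD₂, m₂⟩ := exists_minimal_weight (w := w) e₂
        rw [opt_eq_weight hD₂ m₂, EReal.top_add_coe, EReal.top_sub_coe]
      · rw [opt_eq_top (P := P₂) (by simpa using e₂), EReal.top_add_top, EReal.top_sub_coe]
    · intro D hD
      obtain ⟨E₁, E₂, hE₁, -, -⟩ := h₂ D hD
      exact e₁ ⟨E₁, hE₁⟩

lemma weight_union [DecidableEq V] {D₁ D₂ : Finset V} (h : Disjoint D₁ D₂) :
    weight w (D₁ ∪ D₂) = weight w D₁ + weight w D₂ :=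
  Finset.sum_union h

/-- A condition that splits into independent conditions on two disjoint pieces of the vertex set. -/
lemma opt_split [Fintype V] [DecidableEq V] {S₁ S₂ : Finset V} (hd : Disjoint S₁ S₂)
    (hP₁ : ∀ D, P₁ D → D ⊆ S₁) (hP₂ : ∀ D, P₂ D → D ⊆ S₂) (hP : ∀ D, P D → D ⊆ S₁ ∪ S₂)
    (h : ∀ D ⊆ S₁ ∪ S₂, P D ↔ P₁ (D ∩ S₁) ∧ P₂ (D ∩ S₂)) :
    opt w P = opt w P₁ + opt w P₂ := by
  have := opt_add_eq (w := w) (P := P) (P₁ := P₁) (P₂ := P₂) 0 ?_ ?_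
  · simpa using this
  · intro D₁ D₂ h₁ h₂
    have s₁ := hP₁ _ h₁
    have s₂ := hP₂ _ h₂
    refine ⟨D₁ ∪ D₂, (h _ (Finset.union_subset_union s₁ s₂)).2 ?_, ?_⟩
    · have e₁ : (D₁ ∪ D₂) ∩ S₁ = D₁ := by
        ext x
        have h₁ : x ∈ D₁ → x ∈ S₁ := fun h => s₁ h
        have h₂ : x ∈ D₂ → x ∈ S₂ := fun h => s₂ h
        have h₃ : x ∈ S₁ → x ∉ S₂ := fun h => Finset.disjoint_left.1 hd h
        simp only [Finset.mem_inter, Finset.mem_union]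
        tauto
      have e₂ : (D₁ ∪ D₂) ∩ S₂ = D₂ := by
        ext x
        have h₁ : x ∈ D₁ → x ∈ S₁ := fun h => s₁ h
        have h₂ : x ∈ D₂ → x ∈ S₂ := fun h => s₂ h
        have h₃ : x ∈ S₁ → x ∉ S₂ := fun h => Finset.disjoint_left.1 hd h
        simp only [Finset.mem_inter, Finset.mem_union]
        tauto
      rw [e₁, e₂]
      exact ⟨h₁, h₂⟩
    · rw [weight_union (Finset.disjoint_of_subset_left s₁ (Finset.disjoint_of_subset_right s₂ hd)),
        add_zero]
  · intro D hD
    obtain ⟨h₁, h₂⟩ := (h D (hP D hD)).1 hD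
    refine ⟨_, _, h₁, h₂, ?_⟩
    rw [← weight_union, ← Finset.inter_union_distrib_left, Finset.inter_eq_left.2 (hP D hD),
      add_zero]
    exact Finset.disjoint_of_subset_left Finset.inter_subset_right
      (Finset.disjoint_of_subset_right Finset.inter_subset_right hd)

end Opt

/-! ### Values of a rooted piece of the graph -/

/-- `x` lies in `D` or has a neighbour in `D`. -/
def Dominated {V : Type*} (G : SimpleGraph V) (D : Finset V) (x : V) : Prop :=
  ∃ y ∈ D, y = x ∨ G.Adj y x

/-- `p` holds the four domination parameters of the subgraph of `G` induced by `S` with root `v`,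
where only dominating sets that contain `F` are admitted. -/
structure RootedValues {V : Type*} (G : SimpleGraph V) (w : V → ℝ) (S F : Finset V) (v : V)
    (p : Params) : Prop where
  g1 : p.g1 = opt w fun D => v ∈ D ∧ F ⊆ D ∧ D ⊆ S ∧ ∀ x ∈ S, Dominated G D x
  g0 : p.g0 = opt w fun D => v ∉ D ∧ F ⊆ D ∧ D ⊆ S ∧ ∀ x ∈ S, Dominated G D x
  g00 : p.g00 = opt w fun D => v ∉ D ∧ F ⊆ D ∧ D ⊆ S ∧ ∀ x ∈ S, x ≠ v → Dominated G D x
  g : p.g = min p.g1 p.g0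

section Values

variable {V : Type*} {G : SimpleGraph V} {w : V → ℝ} {S F : Finset V} {v : V} {p : Params}

lemma Dominated.of_mem {D : Finset V} (h : v ∈ D) : Dominated G D v := ⟨v, h, Or.inl rfl⟩

lemma Dominated.mono {D E : Finset V} (hDE : D ⊆ E) (h : Dominated G D v) : Dominated G E v :=
  let ⟨y, hy, hyv⟩ := h
  ⟨y, hDE hy, hyv⟩

lemma RootedValues.g_eq (h : RootedValues G w S F v p) :
    p.g = opt w fun D => F ⊆ D ∧ D ⊆ S ∧ ∀ x ∈ S, Dominated G D x := by
  rw [h.g, h.g1, h.g0, ← opt_or]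
  exact opt_congr fun D => by tauto

lemma RootedValues.min_g1_g00 (h : RootedValues G w S F v p) :
    min p.g1 p.g00 = opt w fun D => F ⊆ D ∧ D ⊆ S ∧ ∀ x ∈ S, x ≠ v → Dominated G D x := by
  rw [h.g1, h.g00, ← opt_or]
  refine opt_congr fun D => ⟨by tauto, fun hD => ?_⟩
  by_cases hv : v ∈ D
  · refine Or.inl ⟨hv, hD.1, hD.2.1, fun x hx => ?_⟩
    by_cases hxv : x = v
    · exact hxv ▸ Dominated.of_mem hv
    · exact hD.2.2 x hx hxv
  · exact Or.inr ⟨hv, hD⟩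

lemma RootedValues.g00_le_g0 (h : RootedValues G w S F v p) : p.g00 ≤ p.g0 := by
  rw [h.g0, h.g00]
  exact opt_anti fun D hD => ⟨hD.1, hD.2.1, hD.2.2.1, fun x hx _ => hD.2.2.2 x hx⟩

lemma RootedValues.unique {q : Params} (hp : RootedValues G w S F v p)
    (hq : RootedValues G w S F v q) : p = q := by
  have h1 := hp.g1.trans hq.g1.symm
  have h0 := hp.g0.trans hq.g0.symm
  have h00 := hp.g00.trans hq.g00.symm
  have hg : p.g = q.g := by rw [hp.g, hq.g, h1, h0]
  cases p
  cases q
  simp_all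

lemma RootedValues.singleton (v : V) : RootedValues G w {v} ∅ v (initParams (w v)) where
  g1 := by
    rw [opt_eq_weight (D := {v})]
    · simp [initParams, weight]
    · simp [Dominated]
    · rintro D ⟨hv, -, hD, -⟩
      rw [Finset.Subset.antisymm hD (Finset.singleton_subset_iff.2 hv)]
  g0 := by
    rw [opt_eq_top]
    · rfl
    · rintro D ⟨hv, -, hD, hdom⟩
      obtain ⟨y, hy, -⟩ := hdom v (Finset.mem_singleton_self v)
      exact hv (Finset.mem_singleton.1 (hD hy) ▸ hy)
  g00 := by
    rw [opt_eq_weight (D := ∅)]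
    · simp [initParams, weight]
    · simp
    · rintro D ⟨hv, -, hD, -⟩
      rcases Finset.subset_singleton_iff.1 hD with rfl | rfl
      · rfl
      · simp at hv
  g := by simp [initParams]

/-- The values depend only on the edges inside the piece. -/
lemma RootedValues.congr_graph {H : SimpleGraph V} (h : RootedValues G w S F v p)
    (hGH : ∀ x ∈ S, ∀ y ∈ S, G.Adj x y ↔ H.Adj x y) : RootedValues H w S F v p := by
  have key : ∀ D ⊆ S, ∀ x ∈ S, (Dominated G D x ↔ Dominated H D x) := by
    intro D hD x hx
    constructor <;> rintro ⟨y, hy, hyx⟩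
    · exact ⟨y, hy, hyx.imp_right (hGH y (hD hy) x hx).1⟩
    · exact ⟨y, hy, hyx.imp_right (hGH y (hD hy) x hx).2⟩
  refine ⟨h.g1.trans (opt_congr fun D => ?_), h.g0.trans (opt_congr fun D => ?_),
    h.g00.trans (opt_congr fun D => ?_), h.g⟩ <;>
  · refine and_congr_right fun _ => and_congr_right fun _ => and_congr_right fun hD =>
      forall₂_congr fun x hx => ?_
    simp only [key D hD x hx]

/-- Requiring the root to be in the dominating set keeps `γ¹` and makes `γ⁰⁰` and `γ⁰` infinite. -/
lemma RootedValues.closed (h : RootedValues G w S ∅ v p) :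
    RootedValues G w S {v} v ⟨⊤, p.g1, ⊤, p.g1⟩ where
  g1 := h.g1.trans (opt_congr fun D => by simp)
  g0 := (opt_eq_top (by rintro D ⟨hv, hF, -⟩; exact hv (by simpa using hF))).symm
  g00 := (opt_eq_top (by rintro D ⟨hv, hF, -⟩; exact hv (by simpa using hF))).symm
  g := by simp

lemma edgeJoinClosed_eq (p q : Params) (hq : q.g00 ≤ q.g0) :
    edgeJoinClosed q p = edgeJoin q ⟨⊤, p.g1, ⊤, p.g1⟩ := by
  have : min (q.g0 + p.g1) (q.g00 + p.g1) = q.g00 + p.g1 := min_eq_right (by gcongr)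
  simp [edgeJoinClosed, edgeJoin, this]

variable [Fintype V] [DecidableEq V]

/-- Joining two disjoint pieces by the single edge between their roots. -/
lemma RootedValues.edgeJoin {T : Finset V} {u : V} {q : Params}
    (hp : RootedValues G w S F v p) (hq : RootedValues G w T ∅ u q)
    (hST : Disjoint S T) (hv : v ∈ S) (hu : u ∈ T) (hFS : F ⊆ S) (huv : G.Adj u v)
    (hedge : ∀ x ∈ S, ∀ y ∈ T, G.Adj x y → x = v ∧ y = u) :
    RootedValues G w (S ∪ T) F u (edgeJoin q p) := by
  have hne : ∀ x ∈ S, x ≠ u := fun x hx h => Finset.disjoint_left.1 hST hx (h ▸ hu)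
  have hTS : T ∪ S = S ∪ T := Finset.union_comm _ _
  have domS : ∀ D ⊆ S ∪ T, ∀ x ∈ S, (Dominated G D x ↔
      Dominated G (D ∩ S) x ∨ (x = v ∧ u ∈ D)) := by
    intro D hD x hx
    constructor
    · rintro ⟨y, hy, hyx⟩
      by_cases hyS : y ∈ S
      · exact Or.inl ⟨y, Finset.mem_inter.2 ⟨hy, hyS⟩, hyx⟩
      · have hyT : y ∈ T := (Finset.mem_union.1 (hD hy)).resolve_left hyS
        rcases hyx with rfl | hyx
        · exact absurd hx hyS
        · obtain ⟨rfl, rfl⟩ := hedge x hx y hyT hyx.symm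
          exact Or.inr ⟨rfl, hy⟩
    · rintro (h | ⟨rfl, h⟩)
      · exact h.mono Finset.inter_subset_left
      · exact ⟨u, h, Or.inr huv⟩
  have domT : ∀ D ⊆ S ∪ T, ∀ x ∈ T, (Dominated G D x ↔
      Dominated G (D ∩ T) x ∨ (x = u ∧ v ∈ D)) := by
    intro D hD x hx
    constructor
    · rintro ⟨y, hy, hyx⟩
      by_cases hyT : y ∈ T
      · exact Or.inl ⟨y, Finset.mem_inter.2 ⟨hy, hyT⟩, hyx⟩
      · have hyS : y ∈ S := (Finset.mem_union.1 (hD hy)).resolve_right hyT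
        rcases hyx with rfl | hyx
        · exact absurd hx hyT
        · obtain ⟨rfl, rfl⟩ := hedge y hyS x hx hyx
          exact Or.inr ⟨rfl, hy⟩
    · rintro (h | ⟨rfl, h⟩)
      · exact h.mono Finset.inter_subset_left
      · exact ⟨v, h, Or.inr huv.symm⟩
  have memS : ∀ D : Finset V, v ∈ D ↔ v ∈ D ∩ S := fun D => by simp [hv]
  have memT : ∀ D : Finset V, u ∈ D ↔ u ∈ D ∩ T := fun D => by simp [hu]
  have subF : ∀ D : Finset V, F ⊆ D ↔ F ⊆ D ∩ S := fun D => by simp [Finset.subset_inter_iff, hFS]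
  -- the condition on the part in `S` when everything there is dominated from inside `S`
  have allS : ∀ D ⊆ S ∪ T, u ∉ D → ((∀ x ∈ S, Dominated G D x) ↔
      ∀ x ∈ S, Dominated G (D ∩ S) x) := fun D hD hu' =>
    forall₂_congr fun x hx => by rw [domS D hD x hx]; simp [hu']
  have hg1 : (CactusDomination.edgeJoin q p).g1 = opt w fun D =>
      u ∈ D ∧ F ⊆ D ∧ D ⊆ S ∪ T ∧ ∀ x ∈ S ∪ T, Dominated G D x := by
    change q.g1 + min p.g1 p.g00 = _
    rw [hp.min_g1_g00, hq.g1]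
    symm
    refine opt_split hST.symm (fun D h => h.2.2.1) (fun D h => h.2.1) (fun D h => hTS ▸ h.2.2.1)
      fun D hD => ?_
    rw [hTS] at hD
    constructor
    · rintro ⟨huD, hF, -, hdom⟩
      refine ⟨⟨(memT D).1 huD, by simp, Finset.inter_subset_right, fun x hx => ?_⟩,
        (subF D).1 hF, Finset.inter_subset_right, fun x hx hxv => ?_⟩
      · rcases (domT D hD x hx).1 (hdom x (Finset.mem_union_right _ hx)) with h | ⟨rfl, -⟩
        · exact h
        · exact Dominated.of_mem ((memT D).1 huD)
      · exact ((domS D hD x hx).1 (hdom x (Finset.mem_union_left _ hx))).resolve_right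
          fun h => hxv h.1
    · rintro ⟨⟨huD, -, -, hT⟩, hF, -, hS⟩
      refine ⟨(memT D).2 huD, (subF D).2 hF, hD, fun x hx => ?_⟩
      rcases Finset.mem_union.1 hx with hx | hx
      · by_cases hxv : x = v
        · exact (domS D hD x hx).2 (Or.inr ⟨hxv, (memT D).2 huD⟩)
        · exact (domS D hD x hx).2 (Or.inl (hS x hx hxv))
      · exact (domT D hD x hx).2 (Or.inl (hT x hx))
  have hg0 : (CactusDomination.edgeJoin q p).g0 = opt w fun D =>
      u ∉ D ∧ F ⊆ D ∧ D ⊆ S ∪ T ∧ ∀ x ∈ S ∪ T, Dominated G D x := by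
    change min (q.g0 + p.g) (q.g00 + p.g1) = _
    -- the root `u` is dominated from inside `T`, or by `v`
    have e₁ : q.g0 + p.g = opt w fun D => u ∉ D ∧ F ⊆ D ∧ D ⊆ S ∪ T ∧
        (∀ x ∈ S ∪ T, Dominated G D x) ∧ ∀ x ∈ T, Dominated G (D ∩ T) x := by
      rw [hp.g_eq, hq.g0]
      symm
      refine opt_split hST.symm (fun D h => h.2.2.1) (fun D h => h.2.1)
        (fun D h => hTS ▸ h.2.2.1) fun D hD => ?_
      rw [hTS] at hD
      constructor
      · rintro ⟨huD, hF, -, hdom, hT⟩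
        exact ⟨⟨fun h => huD ((memT D).2 h), by simp, Finset.inter_subset_right, hT⟩,
          (subF D).1 hF, Finset.inter_subset_right,
          (allS D hD huD).1 fun x hx => hdom x (Finset.mem_union_left _ hx)⟩
      · rintro ⟨⟨huD, -, -, hT⟩, hF, -, hS⟩
        have huD' : u ∉ D := fun h => huD ((memT D).1 h)
        refine ⟨huD', (subF D).2 hF, hD, fun x hx => ?_, hT⟩
        rcases Finset.mem_union.1 hx with hx | hx
        · exact (allS D hD huD').2 hS x hx
        · exact (domT D hD x hx).2 (Or.inl (hT x hx))
    have e₂ : q.g00 + p.g1 = opt w fun D => u ∉ D ∧ F ⊆ D ∧ D ⊆ S ∪ T ∧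
        (∀ x ∈ S ∪ T, Dominated G D x) ∧ v ∈ D := by
      rw [hp.g1, hq.g00]
      symm
      refine opt_split hST.symm (fun D h => h.2.2.1) (fun D h => h.2.2.1)
        (fun D h => hTS ▸ h.2.2.1) fun D hD => ?_
      rw [hTS] at hD
      constructor
      · rintro ⟨huD, hF, -, hdom, hvD⟩
        exact ⟨⟨fun h => huD ((memT D).2 h), by simp, Finset.inter_subset_right, fun x hx hxu =>
          ((domT D hD x hx).1 (hdom x (Finset.mem_union_right _ hx))).resolve_right
            fun h => hxu h.1⟩,
          (memS D).1 hvD, (subF D).1 hF, Finset.inter_subset_right,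
          (allS D hD huD).1 fun x hx => hdom x (Finset.mem_union_left _ hx)⟩
      · rintro ⟨⟨huD, -, -, hT⟩, hvD, hF, -, hS⟩
        have huD' : u ∉ D := fun h => huD ((memT D).1 h)
        refine ⟨huD', (subF D).2 hF, hD, fun x hx => ?_, (memS D).2 hvD⟩
        rcases Finset.mem_union.1 hx with hx | hx
        · exact (allS D hD huD').2 hS x hx
        · by_cases hxu : x = u
          · exact (domT D hD x hx).2 (Or.inr ⟨hxu, (memS D).2 hvD⟩)
          · exact (domT D hD x hx).2 (Or.inl (hT x hx hxu))
    rw [e₁, e₂, ← opt_or]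
    refine opt_congr fun D => ⟨by tauto, fun ⟨huD, hF, hD, hdom⟩ => ?_⟩
    by_cases hvD : v ∈ D
    · exact Or.inr ⟨huD, hF, hD, hdom, hvD⟩
    · refine Or.inl ⟨huD, hF, hD, hdom, fun x hx => ?_⟩
      exact ((domT D hD x hx).1 (hdom x (Finset.mem_union_right _ hx))).resolve_right
        fun h => hvD h.2
  refine ⟨hg1, hg0, ?_, rfl⟩
  change q.g00 + p.g = _
  rw [hp.g_eq, hq.g00]
  symm
  refine opt_split hST.symm (fun D h => h.2.2.1) (fun D h => h.2.1) (fun D h => hTS ▸ h.2.2.1)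
    fun D hD => ?_
  rw [hTS] at hD
  constructor
  · rintro ⟨huD, hF, -, hdom⟩
    exact ⟨⟨fun h => huD ((memT D).2 h), by simp, Finset.inter_subset_right, fun x hx hxu =>
      ((domT D hD x hx).1 (hdom x (Finset.mem_union_right _ hx) hxu)).resolve_right
        fun h => hxu h.1⟩,
      (subF D).1 hF, Finset.inter_subset_right,
      (allS D hD huD).1 fun x hx => hdom x (Finset.mem_union_left _ hx) (hne x hx)⟩
  · rintro ⟨⟨huD, -, -, hT⟩, hF, -, hS⟩
    have huD' : u ∉ D := fun h => huD ((memT D).1 h)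
    refine ⟨huD', (subF D).2 hF, hD, fun x hx hxu => ?_⟩
    rcases Finset.mem_union.1 hx with hx | hx
    · exact (allS D hD huD').2 hS x hx
    · exact (domT D hD x hx).2 (Or.inl (hT x hx hxu))

/-- Gluing two pieces at their common root `v`, the only vertex they share. -/
lemma RootedValues.glue {T : Finset V} {q : Params}
    (hp : RootedValues G w S ∅ v p) (hq : RootedValues G w T ∅ v q)
    (hv : v ∈ S) (hv' : v ∈ T) (hST : ∀ x ∈ S, x ∈ T → x = v)
    (hedge : ∀ x ∈ S, ∀ y ∈ T, G.Adj x y → x = v ∨ y = v) :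
    RootedValues G w (S ∪ T) ∅ v (glue (w v) p q) := by
  -- a vertex other than the root is dominated inside its own piece
  have domS : ∀ D ⊆ S ∪ T, ∀ x ∈ S, x ≠ v → Dominated G D x → Dominated G (D ∩ S) x := by
    rintro D hD x hx hxv ⟨y, hy, hyx⟩
    refine ⟨y, Finset.mem_inter.2 ⟨hy, ?_⟩, hyx⟩
    rcases hyx with rfl | hyx
    · exact hx
    · rcases Finset.mem_union.1 (hD hy) with h | h
      · exact h
      · exact ((hedge x hx y h hyx.symm).resolve_left hxv) ▸ hv
  have domT : ∀ D ⊆ S ∪ T, ∀ x ∈ T, x ≠ v → Dominated G D x → Dominated G (D ∩ T) x := by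
    rintro D hD x hx hxv ⟨y, hy, hyx⟩
    refine ⟨y, Finset.mem_inter.2 ⟨hy, ?_⟩, hyx⟩
    rcases hyx with rfl | hyx
    · exact hx
    · rcases Finset.mem_union.1 (hD hy) with h | h
      · exact ((hedge y h x hx hyx).resolve_right hxv) ▸ hv'
      · exact h
  have domV : ∀ D ⊆ S ∪ T, Dominated G D v → Dominated G (D ∩ S) v ∨ Dominated G (D ∩ T) v := by
    rintro D hD ⟨y, hy, hyv⟩
    rcases Finset.mem_union.1 (hD hy) with h | h
    · exact Or.inl ⟨y, Finset.mem_inter.2 ⟨hy, h⟩, hyv⟩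
    · exact Or.inr ⟨y, Finset.mem_inter.2 ⟨hy, h⟩, hyv⟩
  have hd : Disjoint (S.erase v) (T.erase v) := Finset.disjoint_left.2 fun x hx hx' =>
    Finset.ne_of_mem_erase hx (hST x (Finset.mem_of_mem_erase hx) (Finset.mem_of_mem_erase hx'))
  have inl : ∀ D : Finset V, D ∩ S ⊆ D := fun _ => Finset.inter_subset_left
  have inl' : ∀ D : Finset V, D ∩ T ⊆ D := fun _ => Finset.inter_subset_left
  -- splitting off sets that avoid the root
  have split : ∀ (P P₁ P₂ : Finset V → Prop),
      (∀ D, P₁ D → v ∉ D ∧ D ⊆ S) → (∀ D, P₂ D → v ∉ D ∧ D ⊆ T) →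
      (∀ D, P D → v ∉ D ∧ D ⊆ S ∪ T) →
      (∀ D ⊆ S ∪ T, v ∉ D → (P D ↔ P₁ (D ∩ S) ∧ P₂ (D ∩ T))) →
      opt w P = opt w P₁ + opt w P₂ := by
    intro P P₁ P₂ h₁ h₂ h₀ h
    have er : ∀ D R : Finset V, v ∉ D → D ⊆ R → D ⊆ R.erase v := fun D R hv hD =>
      Finset.subset_erase.2 ⟨hD, hv⟩
    refine opt_split hd (fun D hD => er _ _ (h₁ D hD).1 (h₁ D hD).2)
      (fun D hD => er _ _ (h₂ D hD).1 (h₂ D hD).2)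
      (fun D hD => ?_) fun D hD => ?_
    · rw [← Finset.erase_union_distrib]
      exact er _ _ (h₀ D hD).1 (h₀ D hD).2
    · rw [← Finset.erase_union_distrib, Finset.subset_erase] at hD
      rw [h D hD.1 hD.2, Finset.inter_erase, Finset.inter_erase, Finset.erase_eq_of_notMem,
        Finset.erase_eq_of_notMem] <;>
      simp [hD.2]
  refine ⟨?_, ?_, ?_, rfl⟩
  · change p.g1 + q.g1 - (w v : ℝ) = _
    rw [hp.g1, hq.g1]
    symm
    refine opt_add_eq (w v) ?_ ?_
    · rintro D₁ D₂ ⟨h₁, -, s₁, d₁⟩ ⟨h₂, -, s₂, d₂⟩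
      refine ⟨D₁ ∪ D₂, ⟨Finset.mem_union_left _ h₁, by simp, Finset.union_subset_union s₁ s₂,
        fun x hx => ?_⟩, ?_⟩
      · rcases Finset.mem_union.1 hx with hx | hx
        · exact (d₁ x hx).mono Finset.subset_union_left
        · exact (d₂ x hx).mono Finset.subset_union_right
      · have : D₁ ∩ D₂ = {v} := by
          ext x
          simp only [Finset.mem_inter, Finset.mem_singleton]
          refine ⟨fun hx => hST x (s₁ hx.1) (s₂ hx.2), ?_⟩
          rintro rfl
          exact ⟨h₁, h₂⟩
        have h := Finset.sum_union_inter (s₁ := D₁) (s₂ := D₂) (f := w)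
        rw [this, Finset.sum_singleton] at h
        exact h
    · rintro D ⟨hvD, -, hD, hdom⟩
      refine ⟨D ∩ S, D ∩ T, ⟨by simp [hvD, hv], by simp, Finset.inter_subset_right, fun x hx => ?_⟩,
        ⟨by simp [hvD, hv'], by simp, Finset.inter_subset_right, fun x hx => ?_⟩, ?_⟩
      · by_cases hxv : x = v
        · exact Dominated.of_mem (by simp [hxv, hvD, hv])
        · exact domS D hD x hx hxv (hdom x (Finset.mem_union_left _ hx))
      · by_cases hxv : x = v
        · exact Dominated.of_mem (by simp [hxv, hvD, hv'])
        · exact domT D hD x hx hxv (hdom x (Finset.mem_union_right _ hx))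
      · have : (D ∩ S) ∩ (D ∩ T) = {v} := by
          ext x
          simp only [Finset.mem_inter, Finset.mem_singleton]
          refine ⟨fun hx => hST x hx.1.2 hx.2.2, ?_⟩
          rintro rfl
          exact ⟨⟨hvD, hv⟩, hvD, hv'⟩
        have h := Finset.sum_union_inter (s₁ := D ∩ S) (s₂ := D ∩ T) (f := w)
        rw [this, Finset.sum_singleton, ← Finset.inter_union_distrib_left,
          Finset.inter_eq_left.2 hD] at h
        exact h
  · change min (p.g0 + q.g00) (p.g00 + q.g0) = _
    -- the root is dominated from inside `S`, or from inside `T`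
    have e₁ : p.g0 + q.g00 = opt w fun D => v ∉ D ∧ ∅ ⊆ D ∧ D ⊆ S ∪ T ∧
        (∀ x ∈ S ∪ T, Dominated G D x) ∧ Dominated G (D ∩ S) v := by
      rw [hp.g0, hq.g00]
      symm
      refine split _ _ _ (fun D h => ⟨h.1, h.2.2.1⟩) (fun D h => ⟨h.1, h.2.2.1⟩)
        (fun D h => ⟨h.1, h.2.2.1⟩) fun D hD hvD => ⟨?_, ?_⟩
      · rintro ⟨-, -, -, hdom, hdv⟩
        refine ⟨⟨by simp [hvD], by simp, Finset.inter_subset_right, fun x hx => ?_⟩,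
          by simp [hvD], by simp, Finset.inter_subset_right, fun x hx hxv =>
            domT D hD x hx hxv (hdom x (Finset.mem_union_right _ hx))⟩
        by_cases hxv : x = v
        · exact hxv ▸ hdv
        · exact domS D hD x hx hxv (hdom x (Finset.mem_union_left _ hx))
      · rintro ⟨⟨-, -, -, d₁⟩, -, -, -, d₂⟩
        refine ⟨hvD, by simp, hD, fun x hx => ?_, d₁ v hv⟩
        by_cases hxv : x = v
        · exact hxv ▸ (d₁ v hv).mono (inl D)
        · rcases Finset.mem_union.1 hx with hx | hx
          · exact (d₁ x hx).mono (inl D)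
          · exact (d₂ x hx hxv).mono (inl' D)
    have e₂ : p.g00 + q.g0 = opt w fun D => v ∉ D ∧ ∅ ⊆ D ∧ D ⊆ S ∪ T ∧
        (∀ x ∈ S ∪ T, Dominated G D x) ∧ Dominated G (D ∩ T) v := by
      rw [hp.g00, hq.g0]
      symm
      refine split _ _ _ (fun D h => ⟨h.1, h.2.2.1⟩) (fun D h => ⟨h.1, h.2.2.1⟩)
        (fun D h => ⟨h.1, h.2.2.1⟩) fun D hD hvD => ⟨?_, ?_⟩
      · rintro ⟨-, -, -, hdom, hdv⟩
        refine ⟨⟨by simp [hvD], by simp, Finset.inter_subset_right, fun x hx hxv =>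
            domS D hD x hx hxv (hdom x (Finset.mem_union_left _ hx))⟩,
          by simp [hvD], by simp, Finset.inter_subset_right, fun x hx => ?_⟩
        by_cases hxv : x = v
        · exact hxv ▸ hdv
        · exact domT D hD x hx hxv (hdom x (Finset.mem_union_right _ hx))
      · rintro ⟨⟨-, -, -, d₁⟩, -, -, -, d₂⟩
        refine ⟨hvD, by simp, hD, fun x hx => ?_, d₂ v hv'⟩
        by_cases hxv : x = v
        · exact hxv ▸ (d₂ v hv').mono (inl' D)
        · rcases Finset.mem_union.1 hx with hx | hx
          · exact (d₁ x hx hxv).mono (inl D)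
          · exact (d₂ x hx).mono (inl' D)
    rw [e₁, e₂, ← opt_or]
    refine opt_congr fun D => ⟨by tauto, fun ⟨hvD, hF, hD, hdom⟩ => ?_⟩
    rcases domV D hD (hdom v (Finset.mem_union_left _ hv)) with h | h
    · exact Or.inl ⟨hvD, hF, hD, hdom, h⟩
    · exact Or.inr ⟨hvD, hF, hD, hdom, h⟩
  · change p.g00 + q.g00 = _
    rw [hp.g00, hq.g00]
    symm
    refine split _ _ _ (fun D h => ⟨h.1, h.2.2.1⟩) (fun D h => ⟨h.1, h.2.2.1⟩)
      (fun D h => ⟨h.1, h.2.2.1⟩) fun D hD hvD => ⟨?_, ?_⟩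
    · rintro ⟨-, -, -, hdom⟩
      exact ⟨⟨by simp [hvD], by simp, Finset.inter_subset_right, fun x hx hxv =>
          domS D hD x hx hxv (hdom x (Finset.mem_union_left _ hx) hxv)⟩,
        by simp [hvD], by simp, Finset.inter_subset_right, fun x hx hxv =>
          domT D hD x hx hxv (hdom x (Finset.mem_union_right _ hx) hxv)⟩
    · rintro ⟨⟨-, -, -, d₁⟩, -, -, -, d₂⟩
      refine ⟨hvD, by simp, hD, fun x hx hxv => ?_⟩
      rcases Finset.mem_union.1 hx with hx | hx
      · exact (d₁ x hx hxv).mono (inl D)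
      · exact (d₂ x hx hxv).mono (inl' D)

end Values

/-! ### Values of paths and cycles of pieces -/

section Path

variable {V : Type*} [Fintype V] [DecidableEq V] {G : SimpleGraph V} {w : V → ℝ}
  {B : V → Finset V} {val : V → Params} {nxt : V → V}

/-- PATH-LIKE computes the values of a path of pieces `B y`, joined by edges between their roots.
The first piece `S` may carry a set `F` of prescribed vertices, which covers the closed variant. -/
lemma RootedValues.pathLike {F : Finset V} (hdisj : ∀ y y' z, z ∈ B y → z ∈ B y' → y = y') :
    ∀ (vs : List V) (S : Finset V) (v : V) (p : Params), RootedValues G w S F v p → v ∈ S → F ⊆ S →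
      (v :: vs).IsChain (fun a b => b = nxt a ∧ G.Adj b a) →
      (∀ y ∈ vs, y ∈ B y ∧ RootedValues G w (B y) ∅ y (val y) ∧ Disjoint S (B y) ∧
        ∀ x ∈ S, ∀ z ∈ B y, G.Adj x z → x = v ∧ z = y ∧ y = nxt v) →
      vs.Pairwise (fun a b => a ≠ b ∧
        ∀ x ∈ B a, ∀ z ∈ B b, G.Adj x z → x = a ∧ z = b ∧ b = nxt a) →
      RootedValues G w (S ∪ vs.toFinset.biUnion B) F ((v :: vs).getLast (by simp))
        (pathLike p (vs.map val))
  | [], S, v, p, hp, _, _, _, _, _ => by simpa [CactusDomination.pathLike] using hp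
  | y :: vs, S, v, p, hp, hv, hF, hchain, hy, hpw => by
    rw [List.isChain_cons_cons] at hchain
    rw [List.pairwise_cons] at hpw
    obtain ⟨hyB, hyv, hSy, hSe⟩ := hy y (by simp)
    have hj := hp.edgeJoin hyv hSy hv hyB hF hchain.1.2
      fun x hx z hz h => ⟨(hSe x hx z hz h).1, (hSe x hx z hz h).2.1⟩
    have := RootedValues.pathLike hdisj vs (S ∪ B y) y _ hj (Finset.mem_union_right _ hyB)
      (hF.trans Finset.subset_union_left) hchain.2 ?_ hpw.2
    · simpa [CactusDomination.pathLike, Finset.union_assoc] using this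
    · intro y' hy'
      obtain ⟨h₁, h₂, h₃, h₄⟩ := hy y' (by simp [hy'])
      refine ⟨h₁, h₂, ?_, ?_⟩
      · rw [Finset.disjoint_union_left]
        exact ⟨h₃, Finset.disjoint_left.2 fun z hz hz' =>
          (hpw.1 y' hy').1 (hdisj _ _ z hz hz')⟩
      · intro x hx z hz hxz
        rcases Finset.mem_union.1 hx with hx | hx
        · exact absurd (hchain.1.1.trans (h₄ x hx z hz hxz).2.2.symm) (hpw.1 y' hy').1
        · exact (hpw.1 y' hy').2 x hx z hz hxz

/-- CYCLE-LIKE computes the values, with root `c`, of a cycle `c, p₁, …, pₘ` whose vertices other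
than `c` carry pieces. The copy of `c` in the closed path is realised by deleting the edge
from `c` to the last vertex: then `c` may serve as the first vertex of a path. -/
lemma exists_cycleLike {c p₁ p₂ : V} {rest : List V}
    (hdisj : ∀ y y' z, z ∈ B y → z ∈ B y' → y = y')
    (hB : ∀ y ∈ p₁ :: p₂ :: rest, y ∈ B y ∧ c ∉ B y ∧ RootedValues G w (B y) ∅ y (val y))
    (hchain : (p₁ :: p₂ :: rest).IsChain (fun a b => b = nxt a ∧ G.Adj b a))
    (hpw : (p₁ :: p₂ :: rest).Pairwise (fun a b => a ≠ b ∧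
      ∀ x ∈ B a, ∀ z ∈ B b, G.Adj x z → x = a ∧ z = b ∧ b = nxt a))
    (hc₁ : G.Adj c p₁) (hcm : G.Adj c ((p₁ :: p₂ :: rest).getLast (by simp)))
    (hc : ∀ y ∈ p₁ :: p₂ :: rest, ∀ z ∈ B y, G.Adj c z →
      z = p₁ ∨ z = (p₁ :: p₂ :: rest).getLast (by simp)) :
    ∃ q, cycleLike (initParams (w c)) ((p₁ :: p₂ :: rest).map val) = some q ∧
      RootedValues G w (insert c ((p₁ :: p₂ :: rest).toFinset.biUnion B)) ∅ c q := by
  set L := p₁ :: p₂ :: rest with hL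
  set m := L.getLast (by simp [hL]) with hm
  set U := L.toFinset.biUnion B with hU
  have hmL : m ∈ L := List.getLast_mem _
  have h₁L : p₁ ∈ L := by simp [hL]
  have hcL : c ∉ L := fun h => (hB c h).2.1 (hB c h).1
  have memU : ∀ z, z ∈ U ↔ ∃ y ∈ L, z ∈ B y := fun z => by simp [hU]
  have hcU : c ∉ U := fun h => by
    obtain ⟨y, hy, hz⟩ := (memU c).1 h
    exact (hB y hy).2.1 hz
  have hne : p₁ ≠ m := by
    rw [List.pairwise_cons] at hpw
    refine (hpw.1 m ?_).1
    rw [hm, List.getLast_cons (by simp)]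
    exact List.getLast_mem _
  have hUe : U = B p₁ ∪ (p₂ :: rest).toFinset.biUnion B := by
    rw [hU, hL, List.toFinset_cons, Finset.biUnion_insert]
  have hlast : m = (p₁ :: p₂ :: rest).getLast (by simp) := rfl
  have hpw' := List.pairwise_cons.1 hpw
  have tail : ∀ y ∈ p₂ :: rest, y ∈ B y ∧ RootedValues G w (B y) ∅ y (val y) ∧
      Disjoint (B p₁) (B y) ∧ ∀ x ∈ B p₁, ∀ z ∈ B y, G.Adj x z → x = p₁ ∧ z = y ∧ y = nxt p₁ := by
    intro y hy
    have h := hB y (List.mem_cons_of_mem _ hy)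
    exact ⟨h.1, h.2.2, Finset.disjoint_left.2 fun z hz hz' =>
      (hpw'.1 y hy).1 (hdisj _ _ z hz hz'), (hpw'.1 y hy).2⟩
  have path := RootedValues.pathLike hdisj (p₂ :: rest) (B p₁) p₁ (val p₁) (hB p₁ h₁L).2.2
    (hB p₁ h₁L).1 (by simp) hchain tail hpw'.2
  have half := RootedValues.pathLike hdisj (p₂ :: rest) (B p₁) p₁ _ (hB p₁ h₁L).2.2.closed
    (hB p₁ h₁L).1 (by simpa using (hB p₁ h₁L).1) hchain tail hpw'.2
  rw [← hUe, ← hlast] at path half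
  set H := G.deleteEdges {s(c, m)} with hH
  have hHG : ∀ x y, H.Adj x y ↔ G.Adj x y ∧ s(x, y) ≠ s(c, m) := fun x y => by simp [hH]
  have hGH : ∀ x y, x ≠ c → y ≠ c → (G.Adj x y ↔ H.Adj x y) := by
    intro x y hx hy
    rw [hHG, iff_self_and]
    intro _ h
    rcases Sym2.eq_iff.1 h with h | h
    exacts [hx h.1, hy h.2]
  have hBc : ∀ y ∈ L, ∀ z ∈ B y, z ≠ c := fun y hy z hz h => (hB y hy).2.1 (h ▸ hz)
  have hLc : ∀ y ∈ L, y ≠ c := fun y hy h => hcL (h ▸ hy)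
  have clo := RootedValues.pathLike (G := H) (w := w) (val := val) (nxt := Function.update nxt c p₁)
    hdisj L {c} c _ (RootedValues.singleton c).closed (by simp) (by simp) ?_ ?_ ?_
  rotate_left
  · rw [hL, List.isChain_cons_cons]
    refine ⟨⟨by simp, (hHG _ _).2 ⟨hc₁.symm, fun h => ?_⟩⟩, ?_⟩
    · rcases Sym2.eq_iff.1 h with h | h
      exacts [hLc p₁ h₁L h.1, hne h.1]
    · refine hchain.imp_of_mem_imp fun a b ha hb hab => ?_
      rw [Function.update_of_ne (hLc a ha)]
      exact ⟨hab.1, (hGH _ _ (hLc b hb) (hLc a ha)).1 hab.2⟩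
  · intro y hy
    refine ⟨(hB y hy).1, (hB y hy).2.2.congr_graph fun a ha b hb =>
      hGH a b (hBc y hy a ha) (hBc y hy b hb), by simpa using (hB y hy).2.1, ?_⟩
    intro x hx z hz hxz
    obtain rfl := Finset.mem_singleton.1 hx
    obtain ⟨hxz, hs⟩ := (hHG _ _).1 hxz
    rcases hc y hy z hz hxz with rfl | h
    · have : y = z := hdisj _ _ z hz (hB z h₁L).1
      simp [this]
    · exact absurd (by rw [h]) hs
  · refine hpw.imp_of_mem fun {a b} ha hb hab => ⟨hab.1, fun x hx z hz hxz => ?_⟩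
    rw [Function.update_of_ne (hLc a ha)]
    exact hab.2 x hx z hz ((hHG _ _).1 hxz).1
  rw [List.getLast_cons (by simp [hL]), ← hm, ← hU, ← Finset.insert_eq] at clo
  set pc := CactusDomination.pathLike ⟨⊤, (initParams (w c)).g1, ⊤, (initParams (w c)).g1⟩ (L.map val)
    with hpc
  set pp := CactusDomination.pathLike (val p₁) ((p₂ :: rest).map val) with hpp
  set ph := CactusDomination.pathLike ⟨⊤, (val p₁).g1, ⊤, (val p₁).g1⟩ ((p₂ :: rest).map val)
    with hph
  have ehalf : dClosedPathLike (val p₁) (val p₂) (rest.map val) = ph := by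
    rw [dClosedPathLike, edgeJoinClosed_eq _ _ (hB p₂ (by simp [hL])).2.2.g00_le_g0, hph]
    rfl
  have eclo : (dClosedPathLike (initParams (w c)) (val p₁)
      (val p₂ :: rest.map val ++ [initParams (w c)])).g1 - (initParams (w c)).g1 =
      min pc.g1 pc.g00 := by
    rw [dClosedPathLike, edgeJoinClosed_eq _ _ (hB p₁ h₁L).2.2.g00_le_g0]
    have : CactusDomination.pathLike (edgeJoin (val p₁)
        ⟨⊤, (initParams (w c)).g1, ⊤, (initParams (w c)).g1⟩)
        (val p₂ :: rest.map val ++ [initParams (w c)]) = edgeJoin (initParams (w c)) pc := by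
      simp [CactusDomination.pathLike, hpc, hL]
    rw [this]
    change (w c : EReal) + min pc.g1 pc.g00 - (w c : EReal) = _
    exact EReal.add_sub_cancel_left
  refine ⟨_, rfl, ?_, ?_, ?_, rfl⟩
  · change (dClosedPathLike _ _ _).g1 - _ = _
    rw [eclo, clo.min_g1_g00]
    refine opt_congr fun D => ?_
    constructor
    · rintro ⟨hcD, hD, hdom⟩
      have hcD : c ∈ D := by simpa using hcD
      refine ⟨hcD, by simp, hD, fun x hx => ?_⟩
      by_cases hxm : x = m
      · exact ⟨c, hcD, Or.inr (hxm ▸ hcm)⟩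
      · obtain ⟨y, hy, hyx⟩ := hdom x hx hxm
        exact ⟨y, hy, hyx.imp_right fun h => ((hHG _ _).1 h).1⟩
    · rintro ⟨hcD, -, hD, hdom⟩
      refine ⟨by simpa using hcD, hD, fun x hx hxm => ?_⟩
      obtain ⟨y, hy, hyx⟩ := hdom x hx
      by_cases hxc : x = c
      · exact ⟨c, hcD, Or.inl hxc.symm⟩
      · refine ⟨y, hy, hyx.imp_right fun h => (hHG _ _).2 ⟨h, fun hs => ?_⟩⟩
        rcases Sym2.eq_iff.1 hs with h | h
        exacts [hxm h.2, hxc h.2]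
  · change min pp.g1 (dClosedPathLike (val p₁) (val p₂) (rest.map val)).g = _
    rw [ehalf, path.g1, half.g_eq, ← opt_or]
    have domU : ∀ D ⊆ U, (∀ x ∈ insert c U, Dominated G D x) ↔
        (∀ x ∈ U, Dominated G D x) ∧ (m ∈ D ∨ p₁ ∈ D) := by
      intro D hD
      rw [Finset.forall_mem_insert, and_comm]
      refine and_congr_right fun _ => ⟨?_, ?_⟩
      · rintro ⟨y, hy, rfl | hyc⟩
        · exact absurd (hD hy) hcU
        · obtain ⟨y', hy', hyy'⟩ := (memU y).1 (hD hy)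
          rcases hc y' hy' y hyy' hyc.symm with h | h
          · exact Or.inr (h ▸ hy)
          · exact Or.inl (h ▸ hy)
      · rintro (h | h)
        exacts [⟨m, h, Or.inr hcm.symm⟩, ⟨p₁, h, Or.inr hc₁.symm⟩]
    refine opt_congr fun D => ?_
    constructor
    · intro h
      have hD : D ⊆ U := h.elim (fun h => h.2.2.1) fun h => h.2.1
      refine ⟨fun h => hcU (hD h), by simp, hD.trans (Finset.subset_insert _ _), (domU D hD).2 ?_⟩
      rcases h with ⟨hm, -, -, hdom⟩ | ⟨h₁, -, hdom⟩
      · exact ⟨hdom, Or.inl hm⟩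
      · exact ⟨hdom, Or.inr (Finset.singleton_subset_iff.1 h₁)⟩
    · rintro ⟨hcD, -, hD, hdom⟩
      have hD : D ⊆ U := (Finset.subset_insert_iff_of_notMem hcD).1 hD
      obtain ⟨hdom, hm | h₁⟩ := (domU D hD).1 hdom
      · exact Or.inl ⟨hm, by simp, hD, hdom⟩
      · exact Or.inr ⟨Finset.singleton_subset_iff.2 h₁, hD, hdom⟩
  · change pp.g = _
    rw [path.g_eq]
    refine opt_congr fun D => ?_
    constructor
    · rintro ⟨-, hD, hdom⟩
      exact ⟨fun h => hcU (hD h), by simp, hD.trans (Finset.subset_insert _ _), fun x hx hxc =>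
        hdom x (Finset.mem_of_mem_insert_of_ne hx hxc)⟩
    · rintro ⟨hcD, -, hD, hdom⟩
      exact ⟨by simp, (Finset.subset_insert_iff_of_notMem hcD).1 hD, fun x hx =>
        hdom x (Finset.mem_insert_of_mem hx) fun h => hcU (h ▸ hx)⟩

end Path

/-! ### States whose values are correct -/

section Sound

variable {V : Type*} [Fintype V] [DecidableEq V] {K : SimpleGraph V} {w : V → ℝ}
  {σ : State V} {rep : V → V}

/-- The state `σ` is correct for the partition of the vertex set into the fibres of `rep`. Each fibre
contains exactly one unread vertex, its representative, at which the values of the fibre are stored;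
edges between different fibres connect representatives. -/
structure Sound (K : SimpleGraph V) (w : V → ℝ) (σ : State V) (rep : V → V) : Prop where
  rep_eq : ∀ v ∉ σ.read, rep v = v
  rep_notMem : ∀ v, rep v ∉ σ.read
  adj : ∀ x y, K.Adj x y → rep x = rep y ∨ (x ∉ σ.read ∧ y ∉ σ.read)
  val : ∀ v ∉ σ.read, RootedValues K w (Finset.univ.filter (rep · = v)) ∅ v (σ.val v)

lemma Sound.init : Sound K w (initState w) id where
  rep_eq := by simp
  rep_notMem := by simp [initState]
  adj := by simp [initState]
  val v _ := by
    have : Finset.univ.filter (fun x => id x = v) = {v} := by ext; simp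
    rw [this]
    exact RootedValues.singleton v

/-- A vertex whose only unread neighbour is `u` may be joined to `u`. -/
lemma Sound.joinEdge (h : Sound K w σ rep) {u v : V} (hu : u ∉ σ.read) (hv : v ∉ σ.read)
    (huv : K.Adj u v) (hnb : ∀ y, K.Adj v y → y ∉ σ.read → y = u) :
    Sound K w (σ.joinEdge u v) (fun x => if rep x = v then u else rep x) := by
  have hne : u ≠ v := huv.ne
  have hread : ∀ x, x ∉ (σ.joinEdge u v).read ↔ x ≠ v ∧ x ∉ σ.read := by
    simp [State.joinEdge]
  have hru := h.rep_eq u hu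
  have hrv := h.rep_eq v hv
  refine ⟨?_, ?_, ?_, ?_⟩
  · intro x hx
    rw [hread] at hx
    simp [h.rep_eq x hx.2, hx.1]
  · intro x
    rw [hread]
    split_ifs with hx
    exacts [⟨hne, hu⟩, ⟨hx, h.rep_notMem x⟩]
  · intro x y hxy
    rw [hread, hread]
    rcases h.adj x y hxy with e | ⟨hx, hy⟩
    · exact Or.inl (by simp [e])
    · by_cases hxv : x = v
      · subst hxv
        obtain rfl := hnb y hxy hy
        exact Or.inl (by simp [hru, hrv])
      · by_cases hyv : y = v
        · subst hyv
          obtain rfl := hnb x hxy.symm hx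
          exact Or.inl (by simp [hru, hrv])
        · exact Or.inr ⟨⟨hxv, hx⟩, hyv, hy⟩
  · intro x hx
    rw [hread] at hx
    by_cases hxu : x = u
    · subst hxu
      have hj := (h.val v hv).edgeJoin (h.val x hu) (Finset.disjoint_left.2 fun a ha ha' => hne <| by
        simp only [Finset.mem_filter] at ha ha'; rw [← ha'.2, ha.2]) (by simp [hrv]) (by simp [hru])
        (by simp) huv (fun a ha b hb hab => by
          simp only [Finset.mem_filter, Finset.mem_univ, true_and] at ha hb
          rcases h.adj a b hab with e | ⟨ha', hb'⟩
          · exact absurd (hb.symm.trans (e.symm.trans ha)) hne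
          · rw [h.rep_eq a ha'] at ha
            rw [h.rep_eq b hb'] at hb
            exact ⟨ha, hb⟩)
      have e : Finset.univ.filter (fun a => (if rep a = v then x else rep a) = x) =
          Finset.univ.filter (rep · = v) ∪ Finset.univ.filter (rep · = x) := by
        ext a
        simp only [Finset.mem_filter, Finset.mem_univ, true_and, Finset.mem_union]
        split_ifs with ha <;> simp [ha]
      rw [e]
      simpa [State.joinEdge] using hj
    · have e : Finset.univ.filter (fun a => (if rep a = v then u else rep a) = x) =
          Finset.univ.filter (rep · = x) := by
        ext a
        simp only [Finset.mem_filter, Finset.mem_univ, true_and]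
        split_ifs with ha
        · rw [ha]
          exact ⟨fun e => absurd e.symm hxu, fun e => absurd e.symm hx.1⟩
        · rfl
      rw [e]
      simpa [State.joinEdge, Function.update_of_ne hxu] using h.val x hx.2

/-- A cycle `c, pₘ, …, p₁` such that no `pᵢ` has an unread neighbour outside the cycle may be
contracted to `c`. -/
lemma Sound.cycle (h : Sound K w σ rep) {c p₁ p₂ : V} {rest : List V} {nxt : V → V}
    (hL : ∀ y ∈ p₁ :: p₂ :: rest, y ∉ σ.read ∧ y ≠ c) (hcr : c ∉ σ.read)
    (hchain : (p₁ :: p₂ :: rest).IsChain (fun a b => b = nxt a ∧ K.Adj b a))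
    (hpw : (p₁ :: p₂ :: rest).Pairwise (fun a b => a ≠ b ∧ (K.Adj a b → b = nxt a)))
    (hc₁ : K.Adj c p₁) (hcm : K.Adj c ((p₁ :: p₂ :: rest).getLast (by simp)))
    (hc : ∀ y ∈ p₁ :: p₂ :: rest, K.Adj c y →
      y = p₁ ∨ y = (p₁ :: p₂ :: rest).getLast (by simp))
    (hnb : ∀ y ∈ p₁ :: p₂ :: rest, ∀ z, K.Adj y z → z ∉ σ.read → z ∈ p₁ :: p₂ :: rest ∨ z = c) :
    ∃ q, cycleLike (initParams (w c)) ((p₁ :: p₂ :: rest).map σ.val) = some q ∧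
      Sound K w ⟨Function.update σ.val c (glue (w c) (σ.val c) q),
          σ.read ∪ (p₁ :: p₂ :: rest).toFinset⟩
        (fun x => if rep x ∈ p₁ :: p₂ :: rest then c else rep x) := by
  obtain ⟨q, hq, hqv⟩ := exists_cycleLike (G := K) (w := w) (val := σ.val) (c := c) (p₁ := p₁)
    (p₂ := p₂) (rest := rest) (nxt := nxt) (B := fun y => Finset.univ.filter (rep · = y))
    (fun y y' z hz hz' => by simp_all)
    (fun y hy => ⟨by simp [h.rep_eq y (hL y hy).1], by
      simpa [h.rep_eq c hcr] using (hL y hy).2.symm, h.val y (hL y hy).1⟩)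
    hchain
    (hpw.imp_of_mem fun {a b} ha hb hab => ⟨hab.1, fun x hx z hz hxz => by
      simp only [Finset.mem_filter, Finset.mem_univ, true_and] at hx hz
      rcases h.adj x z hxz with e | ⟨hx', hz'⟩
      · exact absurd (hx.symm.trans (e.trans hz)) hab.1
      · rw [h.rep_eq x hx'] at hx
        rw [h.rep_eq z hz'] at hz
        subst hx hz
        exact ⟨rfl, rfl, hab.2 hxz⟩⟩)
    hc₁ hcm
    (fun y hy z hz hcz => by
      simp only [Finset.mem_filter, Finset.mem_univ, true_and] at hz
      rcases h.adj c z hcz with e | ⟨hx', hz'⟩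
      · rw [hz, h.rep_eq c hcr] at e
        exact absurd e.symm (hL y hy).2
      · rw [h.rep_eq z hz'] at hz
        exact hz ▸ hc z (hz ▸ hy) hcz)
  refine ⟨q, hq, ?_⟩
  clear hc hcm hpw hchain
  generalize hLd : p₁ :: p₂ :: rest = L at *
  have hcL : c ∉ L := fun h => (hL c h).2 rfl
  have hrc := h.rep_eq c hcr
  have hLr : ∀ y ∈ L, rep y = y := fun y hy => h.rep_eq y (hL y hy).1
  have hread : ∀ x, x ∉ σ.read ∪ L.toFinset ↔ x ∉ L ∧ x ∉ σ.read := by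
    intro x; simp [and_comm]
  refine ⟨?_, ?_, ?_, ?_⟩
  · intro x hx
    rw [hread] at hx
    simp [h.rep_eq x hx.2, hx.1]
  · intro x
    rw [hread]
    split_ifs with hx
    exacts [⟨hcL, hcr⟩, ⟨hx, h.rep_notMem x⟩]
  · intro x y hxy
    rw [hread, hread]
    rcases h.adj x y hxy with e | ⟨hx, hy⟩
    · exact Or.inl (by simp [e])
    · by_cases hxL : x ∈ L
      · rcases hnb x hxL y hxy hy with hyL | rfl
        · exact Or.inl (by simp [hLr, hxL, hyL])
        · exact Or.inl (by simp [hLr, hxL, hrc])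
      · by_cases hyL : y ∈ L
        · rcases hnb y hyL x hxy.symm hx with hxL' | rfl
          · exact absurd hxL' hxL
          · exact Or.inl (by simp [hLr, hyL, hrc])
        · exact Or.inr ⟨⟨hxL, hx⟩, hyL, hy⟩
  · intro x hx
    rw [hread] at hx
    by_cases hxc : x = c
    · subst hxc
      have hT : ∀ a, a ∈ insert x (L.toFinset.biUnion fun y => Finset.univ.filter (rep · = y)) ↔
          a = x ∨ rep a ∈ L := by
        intro a
        simp
      have hj := (h.val x hcr).glue hqv (by simp [hrc]) (by simp)
        (fun a ha ha' => by
          simp only [Finset.mem_filter, Finset.mem_univ, true_and] at ha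
          rcases (hT a).1 ha' with h | h
          · exact h
          · exact absurd (ha ▸ h) hcL)
        (fun a ha b hb hab => by
          simp only [Finset.mem_filter, Finset.mem_univ, true_and] at ha
          rcases (hT b).1 hb with hb | hb
          · exact Or.inr hb
          · rcases h.adj a b hab with e | ⟨ha', -⟩
            · exact absurd (ha ▸ e ▸ hb) hcL
            · exact Or.inl ((h.rep_eq a ha').symm.trans ha))
      have e : Finset.univ.filter (fun a => (if rep a ∈ L then x else rep a) = x) =
          Finset.univ.filter (rep · = x) ∪
            insert x (L.toFinset.biUnion fun y => Finset.univ.filter (rep · = y)) := by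
        ext a
        rw [Finset.mem_union, hT]
        simp only [Finset.mem_filter, Finset.mem_univ, true_and]
        split_ifs with ha
        · simp [ha]
        · simp only [ha, or_false, iff_self_or]
          rintro rfl
          exact hrc
      rw [e]
      simpa using hj
    · have e : Finset.univ.filter (fun a => (if rep a ∈ L then c else rep a) = x) =
          Finset.univ.filter (rep · = x) := by
        ext a
        simp only [Finset.mem_filter, Finset.mem_univ, true_and]
        split_ifs with ha
        · exact ⟨fun e => absurd e.symm hxc, fun e => absurd (e ▸ ha) hx.1⟩
        · rfl
      rw [e]
      simpa [Function.update_of_ne hxc] using h.val x hx.2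

/-- When only `r` is unread, its values are the domination parameters of `K` with root `r`. -/
lemma Sound.final (h : Sound K w σ rep) {r : V} (hread : ∀ x, x ∉ σ.read ↔ x = r) :
    RootedValues K w Finset.univ ∅ r (σ.val r) := by
  have e : Finset.univ.filter (rep · = r) = Finset.univ := by
    ext a
    simpa using (hread _).1 (h.rep_notMem a)
  exact e ▸ h.val r ((hread r).2 rfl)

end Sound

/-! ### The parameters of the whole graph -/

section Gamma

variable {V : Type*} [Fintype V] {K : SimpleGraph V} {w : V → ℝ} {r : V}
  {p : Params}

lemma RootedValues.eq_gammaW (h : RootedValues K w Finset.univ ∅ r p) : p.g = gammaW K w := by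
  rw [h.g_eq]
  exact opt_congr fun D => by simp [IsDominating, Dominated]

lemma RootedValues.eq_gamma1 (h : RootedValues K w Finset.univ ∅ r p) : p.g1 = gamma1 K w r := by
  rw [h.g1, gamma1, opt]
  congr 1
  ext x
  refine exists_congr fun D => ?_
  simp [IsDominating, Dominated, and_left_comm, and_assoc]

lemma RootedValues.eq_gamma0 (h : RootedValues K w Finset.univ ∅ r p) : p.g0 = gamma0 K w r := by
  rw [h.g0, gamma0, opt]
  congr 1
  ext x
  refine exists_congr fun D => ?_
  simp [IsDominating, Dominated, and_left_comm, and_assoc]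

lemma RootedValues.eq_gamma00 (h : RootedValues K w Finset.univ ∅ r p) :
    p.g00 = gamma00 K w r := by
  have hw : ∀ D : Finset {x | x ≠ r}, weight (fun x : {x | x ≠ r} => w x) D =
      weight w (D.map (Function.Embedding.subtype _)) := fun D => by
    rw [weight, weight, Finset.sum_map]
    rfl
  classical
  have := Fintype.ofFinite {x | x ≠ r}
  rw [h.g00, gamma00, gammaW, opt]
  congr 1
  ext x
  simp only [Set.mem_ofPred_eq]
  constructor
  · rintro ⟨D, ⟨hr, -, -, hdom⟩, rfl⟩
    refine ⟨Finset.univ.filter fun y => (y : V) ∈ D, ?_, ?_⟩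
    · rintro ⟨v, hv⟩
      obtain ⟨y, hy, hyv⟩ := hdom v (Finset.mem_univ v) hv
      have hyr : y ≠ r := fun e => hr (e ▸ hy)
      exact ⟨⟨y, hyr⟩, by simpa using hy, by simpa [Subtype.ext_iff] using hyv⟩
    · rw [hw]
      congr 2
      ext y
      have : y ∈ D → y ≠ r := fun hy e => hr (e ▸ hy)
      simpa using this
  · rintro ⟨D, hD, rfl⟩
    refine ⟨D.map (Function.Embedding.subtype _), ⟨by simp, by simp, by simp, ?_⟩, by rw [hw]⟩
    intro v _ hv
    obtain ⟨y, hy, hyv⟩ := hD ⟨v, hv⟩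
    exact ⟨y, Finset.mem_map_of_mem _ hy, by simpa [Subtype.ext_iff] using hyv⟩

end Gamma

/-! ### Depth first search trees -/

/-- `a` is an ancestor of `x`, or `x` itself, for the father function `f`. -/
def IsAnc {V : Type*} (f : V → V) (a x : V) : Prop := ∃ k, f^[k] x = a

section Anc

variable {V : Type*} {f : V → V} {a b x : V}

lemma IsAnc.refl (f : V → V) (x : V) : IsAnc f x x := ⟨0, rfl⟩

lemma IsAnc.father (f : V → V) (x : V) : IsAnc f (f x) x := ⟨1, rfl⟩

lemma IsAnc.trans (h : IsAnc f a b) (h' : IsAnc f b x) : IsAnc f a x := by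
  obtain ⟨k, rfl⟩ := h
  obtain ⟨l, rfl⟩ := h'
  exact ⟨k + l, Function.iterate_add_apply f k l x⟩

lemma isAnc_iff : IsAnc f a x ↔ a = x ∨ IsAnc f a (f x) := by
  constructor
  · rintro ⟨_ | k, h⟩
    · exact Or.inl h.symm
    · exact Or.inr ⟨k, h⟩
  · rintro (rfl | h)
    · exact IsAnc.refl f a
    · exact h.trans (IsAnc.father f x)

lemma IsAnc.of_ne (h : IsAnc f a x) (hne : a ≠ x) : IsAnc f a (f x) :=
  (isAnc_iff.1 h).resolve_left hne

lemma IsAnc.eq_of_fixed (h : IsAnc f a x) (hx : f x = x) : a = x := by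
  obtain ⟨k, rfl⟩ := h
  exact Function.iterate_fixed hx k

/-- Changing the father of a vertex outside a set closed under fathers does not affect the
ancestors of the vertices in this set. -/
lemma isAnc_update [DecidableEq V] {s : List V} (hs : ∀ y ∈ s, f y ∈ s) {w v : V} (hw : w ∉ s)
    (hx : x ∈ s) : IsAnc (Function.update f w v) a x ↔ IsAnc f a x := by
  have key : ∀ k, f^[k] x ∈ s ∧ (Function.update f w v)^[k] x = f^[k] x := by
    intro k
    induction k with
    | zero => exact ⟨hx, rfl⟩
    | succ k ih =>
      rw [Function.iterate_succ_apply', Function.iterate_succ_apply', ih.2]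
      exact ⟨hs _ ih.1, Function.update_of_ne (fun (e : f^[k] x = w) => hw (e ▸ ih.1)) _ _⟩
  exact exists_congr fun k => by rw [(key k).2]

end Anc

/-- The invariant of depth first search: the unfinished vertices are the ancestors of the current
vertex `v`, and the descendants of an unfinished vertex are the vertices visited after it. -/
structure DFSInvariant {V : Type*} [DecidableEq V] (G : SimpleGraph V) (r v : V) (ord : List V)
    (f : V → V) : Prop where
  nodup : ord.Nodup
  root_mem : r ∈ ord
  mem : v ∈ ord
  root : f r = r
  father : ∀ x ∈ ord, x ≠ r → f x ∈ ord ∧ G.Adj (f x) x ∧ ord.idxOf (f x) < ord.idxOf x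
  desc : ∀ a, IsAnc f a v → ∀ y ∈ ord, ord.idxOf a ≤ ord.idxOf y → IsAnc f a y
  finished : ∀ x ∈ ord, ¬ IsAnc f x v → ∀ y, G.Adj x y → y ∈ ord
  edge : ∀ x ∈ ord, ∀ y ∈ ord, G.Adj x y → ord.idxOf x < ord.idxOf y → IsAnc f x y
  interval : ∀ a, ∀ x ∈ ord, ∀ y ∈ ord, IsAnc f a x → ord.idxOf a ≤ ord.idxOf y →
    ord.idxOf y ≤ ord.idxOf x → IsAnc f a y

section DFS

variable {V : Type*} [DecidableEq V] {G : SimpleGraph V} {r v : V} {ord : List V} {f : V → V}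

lemma DFSInvariant.father_mem (h : DFSInvariant G r v ord f) : ∀ x ∈ ord, f x ∈ ord := by
  intro x hx
  by_cases hxr : x = r
  · rw [hxr, h.root]
    exact h.root_mem
  · exact (h.father x hx hxr).1

lemma DFSInvariant.anc_mem (h : DFSInvariant G r v ord f) {a x : V} (hx : x ∈ ord)
    (ha : IsAnc f a x) : a ∈ ord := by
  obtain ⟨k, rfl⟩ := ha
  induction k with
  | zero => exact hx
  | succ k ih =>
    rw [Function.iterate_succ_apply']
    exact h.father_mem _ ih

lemma DFSInvariant.visit (h : DFSInvariant G r v ord f) {w : V} (hvw : G.Adj v w) (hw : w ∉ ord) :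
    DFSInvariant G r w (ord ++ [w]) (Function.update f w v) := by
  have hmem : ∀ x, x ∈ ord ++ [w] ↔ x ∈ ord ∨ x = w := by simp
  have hne : ∀ x ∈ ord, x ≠ w := fun x hx e => hw (e ▸ hx)
  have hidx : ∀ x ∈ ord, (ord ++ [w]).idxOf x = ord.idxOf x := fun x hx =>
    List.idxOf_append_of_mem hx
  have hidw : (ord ++ [w]).idxOf w = ord.length := by
    rw [List.idxOf_append_of_notMem hw]; simp
  have hlt : ∀ x ∈ ord, ord.idxOf x < ord.length := fun x hx => List.idxOf_lt_length_of_mem hx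
  have hanc : ∀ a, ∀ x ∈ ord, IsAnc (Function.update f w v) a x ↔ IsAnc f a x :=
    fun a x hx => isAnc_update h.father_mem hw hx
  have hancw : ∀ a, IsAnc (Function.update f w v) a w ↔ a = w ∨ IsAnc f a v := fun a => by
    rw [isAnc_iff, Function.update_self, hanc a v h.mem]
  -- the vertices visited after an ancestor of `w` are its descendants
  have hdesc : ∀ a, IsAnc (Function.update f w v) a w → ∀ y ∈ ord ++ [w],
      (ord ++ [w]).idxOf a ≤ (ord ++ [w]).idxOf y → IsAnc (Function.update f w v) a y := by
    intro a ha y hy hay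
    rcases (hmem y).1 hy with hy' | rfl
    · rcases (hancw a).1 ha with rfl | ha
      · rw [hidw, hidx y hy'] at hay
        exact absurd hay (hlt y hy').not_ge
      · rw [hidx a (h.anc_mem h.mem ha), hidx y hy'] at hay
        exact (hanc a y hy').2 (h.desc a ha y hy' hay)
    · exact ha
  refine ⟨?_, by simp [h.root_mem], by simp, ?_, ?_, hdesc, ?_, ?_, ?_⟩
  · rw [List.nodup_append_comm]
    simpa using ⟨hw, h.nodup⟩
  · rw [Function.update_of_ne (hne r h.root_mem), h.root]
  · intro x hx hxr
    rcases (hmem x).1 hx with hx | rfl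
    · rw [Function.update_of_ne (hne x hx)]
      obtain ⟨h₁, h₂, h₃⟩ := h.father x hx hxr
      exact ⟨by simp [h₁], h₂, by rwa [hidx x hx, hidx _ h₁]⟩
    · rw [Function.update_self]
      exact ⟨by simp [h.mem], hvw, by rw [hidw, hidx v h.mem]; exact hlt v h.mem⟩
  · intro x hx hxw y hxy
    rcases (hmem x).1 hx with hx | rfl
    · rw [hancw, not_or] at hxw
      simp [h.finished x hx hxw.2 y hxy]
    · exact absurd (IsAnc.refl _ _) hxw
  · intro x hx y hy hxy hlt'
    rcases (hmem x).1 hx with hx' | rfl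
    · rcases (hmem y).1 hy with hy' | rfl
      · rw [hidx x hx', hidx y hy'] at hlt'
        exact (hanc x y hy').2 (h.edge x hx' y hy' hxy hlt')
      · refine (hancw x).2 (Or.inr ?_)
        by_contra hxv
        exact hw (h.finished x hx' hxv y hxy)
    · rcases (hmem y).1 hy with hy' | rfl
      · rw [hidw, hidx y hy'] at hlt'
        exact absurd hlt' (hlt y hy').not_gt
      · exact absurd rfl hxy.ne
  · intro a x hx y hy hax hay hyx
    rcases (hmem x).1 hx with hx' | rfl
    · rcases (hmem y).1 hy with hy' | rfl
      · rw [hanc a x hx'] at hax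
        rw [hidx a (h.anc_mem hx' hax), hidx y hy'] at hay
        rw [hidx y hy', hidx x hx'] at hyx
        exact (hanc a y hy').2 (h.interval a x hx' y hy' hax hay hyx)
      · rw [hidw, hidx x hx'] at hyx
        exact absurd hyx (hlt x hx').not_ge
    · exact hdesc a hax y hy hay

lemma DFSReach.invariant (h : DFSReach G r v ord f) : DFSInvariant G r v ord f := by
  induction h with
  | init =>
    have hid : ∀ a x : V, IsAnc id a x ↔ a = x := fun a x =>
      ⟨fun h => h.eq_of_fixed rfl, fun h => h ▸ IsAnc.refl _ _⟩
    refine ⟨by simp, by simp, by simp, rfl, by simp, ?_, by simp [hid], ?_, ?_⟩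
    · simp only [hid, List.mem_singleton]
      rintro a rfl y rfl -
      rfl
    · simp only [List.mem_singleton]
      rintro x rfl y rfl hxy
      exact absurd rfl hxy.ne
    · simp only [List.mem_singleton]
      rintro a x rfl y rfl h - -
      exact h
  | visit _ hvw hw ih => exact ih.visit hvw hw
  | @back v ord f _ hvr hall ih =>
    have hup : ∀ a, IsAnc f a (f v) → IsAnc f a v := fun a ha => ha.trans (IsAnc.father f v)
    refine ⟨ih.nodup, ih.root_mem, ih.father_mem v ih.mem, ih.root, ih.father,
      fun a ha => ih.desc a (hup a ha), ?_, ih.edge, ih.interval⟩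
    intro x hx hxv y hxy
    by_cases hxv' : x = v
    · exact hall y (hxv' ▸ hxy)
    · exact ih.finished x hx (fun h => hxv (h.of_ne hxv')) y hxy

end DFS

/-- The properties of a complete depth first search tree with father function `f` and order of first
visits `d`: every edge joins a vertex to one of its ancestors, and the descendants of a vertex form
an interval. -/
structure DFSTree {V : Type*} (K : SimpleGraph V) (r : V) (f : V → V) (d : V → ℕ) : Prop where
  inj : Function.Injective d
  root : f r = r
  adj : ∀ x, x ≠ r → K.Adj (f x) x
  lt : ∀ x, x ≠ r → d (f x) < d x
  edge : ∀ x y, K.Adj x y → d x < d y → IsAnc f x y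
  interval : ∀ a x y, IsAnc f a x → d a ≤ d y → d y ≤ d x → IsAnc f a y

lemma DFSTable.IsDFSTableOf.nodup_and_mem {V : Type*} [DecidableEq V] {K : SimpleGraph V}
    (hK : K.Connected) {r : V} {T : DFSTable V} (hT : T.IsDFSTableOf K r) :
    T.order.Nodup ∧ ∀ x, x ∈ T.order := by
  have h := hT.search.invariant
  refine ⟨h.nodup, fun x => ?_⟩
  have hclosed : ∀ x ∈ T.order, ∀ y, K.Adj x y → y ∈ T.order := by
    intro x hx y hxy
    by_cases hxr : IsAnc T.father x r
    · exact hT.complete y (hxr.eq_of_fixed h.root ▸ hxy)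
    · exact h.finished x hx hxr y hxy
  obtain ⟨p⟩ := hK.preconnected r x
  by_contra hx
  obtain ⟨d, -, hd, hd'⟩ := p.exists_boundary_dart {y | y ∈ T.order} h.root_mem hx
  exact hd' (hclosed _ hd _ d.adj)

lemma DFSTable.IsDFSTableOf.dfsTree {V : Type*} [DecidableEq V] {K : SimpleGraph V}
    (hK : K.Connected) {r : V} {T : DFSTable V} (hT : T.IsDFSTableOf K r) :
    DFSTree K r T.father T.dfn := by
  have h := hT.search.invariant
  have hmem := (hT.nodup_and_mem hK).2
  exact {
    inj := fun x y hxy => (List.idxOf_inj (hmem x)).1 hxy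
    root := h.root
    adj := fun x hx => (h.father x (hmem x) hx).2.1
    lt := fun x hx => (h.father x (hmem x) hx).2.2
    edge := fun x y => h.edge x (hmem x) y (hmem y)
    interval := fun a x y => h.interval a x (hmem x) y (hmem y) }

section Tree

variable {V : Type*} {K : SimpleGraph V} {r a b x y v : V} {f : V → V} {d : V → ℕ}

lemma DFSTree.father_le (h : DFSTree K r f d) (x : V) : d (f x) ≤ d x := by
  by_cases hx : x = r
  · rw [hx, h.root]
  · exact (h.lt x hx).le

lemma DFSTree.anc_le (h : DFSTree K r f d) (hax : IsAnc f a x) : d a ≤ d x := by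
  obtain ⟨k, rfl⟩ := hax
  induction k with
  | zero => rfl
  | succ k ih =>
    rw [Function.iterate_succ_apply']
    exact (h.father_le _).trans ih

lemma DFSTree.anc_antisymm (h : DFSTree K r f d) (hab : IsAnc f a b) (hba : IsAnc f b a) :
    a = b :=
  h.inj (le_antisymm (h.anc_le hab) (h.anc_le hba))

lemma DFSTree.anc_lt (h : DFSTree K r f d) (hax : IsAnc f a x) (hne : a ≠ x) : d a < d x :=
  lt_of_le_of_ne (h.anc_le hax) fun e => hne (h.inj e)

lemma DFSTree.ne_root (h : DFSTree K r f d) (hax : IsAnc f a x) (hne : a ≠ x) : x ≠ r := by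
  rintro rfl
  exact hne (hax.eq_of_fixed h.root)

/-- Two ancestors of a vertex are comparable. -/
lemma DFSTree.anc_of_le (h : DFSTree K r f d) (ha : IsAnc f a x) (hb : IsAnc f b x)
    (hab : d a ≤ d b) : IsAnc f a b :=
  h.interval a x b ha hab (h.anc_le hb)

lemma DFSTree.root_anc (h : DFSTree K r f d) (x : V) : IsAnc f r x := by
  induction hn : d x using Nat.strong_induction_on generalizing x with
  | _ n ih =>
    by_cases hx : x = r
    · rw [hx]; exact IsAnc.refl _ _
    · exact (ih _ (hn ▸ h.lt x hx) _ rfl).trans (IsAnc.father f x)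

/-! ### Back edges and cycles -/

/-- The tree path from `b` to its ancestor `a`. -/
lemma DFSTree.exists_path (h : DFSTree K r f d) (hab : IsAnc f a b) :
    ∃ q : K.Walk b a, q.IsPath ∧ (∀ z, z ∈ q.support ↔ IsAnc f a z ∧ IsAnc f z b) ∧
      ∀ e ∈ q.edges, ∃ z, z ≠ r ∧ e = s(z, f z) := by
  induction hn : d b using Nat.strong_induction_on generalizing b with
  | _ n ih =>
    by_cases hne : a = b
    · subst hne
      refine ⟨.nil, by simp, fun z => ?_, by simp⟩
      simp only [SimpleGraph.Walk.support_nil, List.mem_singleton]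
      exact ⟨fun e => e ▸ ⟨IsAnc.refl _ _, IsAnc.refl _ _⟩, fun hz => h.anc_antisymm hz.2 hz.1⟩
    · have hbr := h.ne_root hab hne
      obtain ⟨q, hq, hs, he⟩ := ih _ (hn ▸ h.lt b hbr) (hab.of_ne hne) rfl
      refine ⟨.cons (h.adj b hbr).symm q, ?_, fun z => ?_, ?_⟩
      · refine hq.cons fun hb => ?_
        exact (h.lt b hbr).not_ge (h.anc_le ((hs b).1 hb).2)
      · rw [SimpleGraph.Walk.support_cons, List.mem_cons, hs]
        constructor
        · rintro (rfl | hz)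
          · exact ⟨hab, IsAnc.refl _ _⟩
          · exact ⟨hz.1, hz.2.trans (IsAnc.father f b)⟩
        · rintro ⟨hz, hz'⟩
          exact (isAnc_iff.1 hz').imp_right fun h => ⟨hz, h⟩
      · intro e hmem
        rcases List.mem_cons.1 (SimpleGraph.Walk.edges_cons _ _ ▸ hmem) with rfl | hmem
        · exact ⟨b, hbr, rfl⟩
        · exact he e hmem

/-- `a b` is a back edge from `b` to its ancestor `a`, and `v` is one of the vertices below `a` on
the tree path from `a` to `b`. -/
structure Covers (K : SimpleGraph V) (f : V → V) (a b v : V) : Prop where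
  adj : K.Adj a b
  ne_father : a ≠ f b
  ne : a ≠ v
  left : IsAnc f a v
  right : IsAnc f v b

lemma Covers.of_between (h : Covers K f a b v) (hne : a ≠ x) (hax : IsAnc f a x)
    (hxb : IsAnc f x b) : Covers K f a b x :=
  ⟨h.adj, h.ne_father, hne, hax, hxb⟩

/-- The cycle that consists of a back edge and a tree path. -/
lemma Covers.exists_cycle (hC : Covers K f a b v) (h : DFSTree K r f d) :
    ∃ c : K.Walk a a, c.IsCycle ∧ ∀ z, z ∈ c.support ↔ IsAnc f a z ∧ IsAnc f z b := by
  obtain ⟨q, hq, hs, he⟩ := h.exists_path (hC.left.trans hC.right)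
  refine ⟨.cons hC.adj q, ?_, fun z => ?_⟩
  · rw [SimpleGraph.Walk.cons_isCycle_iff]
    refine ⟨hq, fun hmem => ?_⟩
    obtain ⟨z, hzr, hz⟩ := he _ hmem
    rcases Sym2.eq_iff.1 hz with ⟨rfl, rfl⟩ | ⟨rfl, rfl⟩
    · exact (h.lt a hzr).not_ge (h.anc_le (hC.left.trans hC.right))
    · exact hC.ne_father rfl
  · rw [SimpleGraph.Walk.support_cons, List.mem_cons, hs]
    constructor
    · rintro (rfl | hz)
      exacts [⟨IsAnc.refl _ _, hC.left.trans hC.right⟩, hz]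
    · exact Or.inr

/-- In a cactus, every vertex is covered by at most one back edge: the cycles of two such edges
would share the vertex and its father. -/
lemma Covers.unique {a' b' : V} (hC : Covers K f a b v) (hC' : Covers K f a' b' v)
    (h : DFSTree K r f d) (hK : IsCactus K) : a = a' ∧ b = b' := by
  obtain ⟨c, hc, hs⟩ := hC.exists_cycle h
  obtain ⟨c', hc', hs'⟩ := hC'.exists_cycle h
  have hvr := h.ne_root hC.left hC.ne
  have heq : c.toSubgraph = c'.toSubgraph := by
    by_contra hne
    have := hK.2 a a' c c' hc hc' hne v (f v) ((hs v).2 ⟨hC.left, hC.right⟩)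
      ((hs' v).2 ⟨hC'.left, hC'.right⟩)
      ((hs _).2 ⟨hC.left.of_ne hC.ne, (IsAnc.father f v).trans hC.right⟩)
      ((hs' _).2 ⟨hC'.left.of_ne hC'.ne, (IsAnc.father f v).trans hC'.right⟩)
    exact (h.adj v hvr).ne this.symm
  have hmem : ∀ z, z ∈ c.support ↔ z ∈ c'.support := fun z => by
    rw [← SimpleGraph.Walk.mem_verts_toSubgraph, heq, SimpleGraph.Walk.mem_verts_toSubgraph]
  simp only [hs, hs'] at hmem
  have hab := hC.left.trans hC.right
  have hab' := hC'.left.trans hC'.right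
  exact ⟨h.anc_antisymm ((hmem a').2 ⟨IsAnc.refl _ _, hab'⟩).1
      ((hmem a).1 ⟨IsAnc.refl _ _, hab⟩).1,
    h.anc_antisymm ((hmem b).1 ⟨hab, IsAnc.refl _ _⟩).2
      ((hmem b').2 ⟨hab', IsAnc.refl _ _⟩).2⟩

/-- An edge that leaves the subtree of `v` is the tree edge from `v` to its father or a back edge
that covers `v`. -/
lemma DFSTree.leaving_edge (h : DFSTree K r f d) (hxy : K.Adj y x) (hy : IsAnc f v y)
    (hx : ¬ IsAnc f v x) : s(y, x) = s(v, f v) ∨ Covers K f x y v := by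
  have hlt : d x < d y := by
    by_contra hle
    exact hx (hy.trans (h.edge y x hxy (lt_of_le_of_ne (not_lt.1 hle) fun e => hxy.ne (h.inj e))))
  have hanc := h.edge x y hxy.symm hlt
  by_cases hf : x = f y
  · left
    by_cases hvy : v = y
    · rw [hf, hvy]
    · exact absurd (hf ▸ hy.of_ne hvy) hx
  · refine Or.inr ⟨hxy.symm, hf, fun e => hx (e ▸ IsAnc.refl _ _), ?_, hy⟩
    rcases le_total (d x) (d v) with hle | hle
    · exact h.anc_of_le hanc hy hle
    · exact absurd (h.anc_of_le hy hanc hle) hx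

/-- A cycle that leaves the subtree of its vertex `v` crosses the boundary of the subtree twice, so
it uses a back edge that covers `v`. -/
lemma DFSTree.exists_covers [DecidableEq V] (h : DFSTree K r f d) {o ρ : V} {c : K.Walk o o}
    (hc : c.IsCycle) (hv : v ∈ c.support) (hρ : ρ ∈ c.support) (hvρ : ¬ IsAnc f v ρ) :
    ∃ a b, Covers K f a b v ∧ a ∈ c.support ∧ b ∈ c.support := by
  have hc' := hc.rotate hv
  have hsup : ∀ z, z ∈ (c.rotate v hv).support ↔ z ∈ c.support :=
    fun z => c.mem_support_rotate_iff v hv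
  generalize c.rotate v hv = c' at hc' hsup
  have hρ' := (hsup ρ).2 hρ
  have hspec := c'.take_spec hρ'
  obtain ⟨e₁, he₁, hin₁, hout₁⟩ := (c'.takeUntil ρ hρ').exists_boundary_dart {z | IsAnc f v z}
    (IsAnc.refl _ _) hvρ
  obtain ⟨e₂, he₂, hin₂, hout₂⟩ := (c'.dropUntil ρ hρ').reverse.exists_boundary_dart
    {z | IsAnc f v z} (IsAnc.refl _ _) hvρ
  have hm₁ : e₁.edge ∈ (c'.takeUntil ρ hρ').edges := List.mem_map_of_mem he₁
  have hm₂ : e₂.edge ∈ (c'.dropUntil ρ hρ').edges := by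
    have : e₂.edge ∈ (c'.dropUntil ρ hρ').reverse.edges := List.mem_map_of_mem he₂
    simpa using this
  have hedges : c'.edges = (c'.takeUntil ρ hρ').edges ++ (c'.dropUntil ρ hρ').edges := by
    rw [← SimpleGraph.Walk.edges_append, hspec]
  have hne : e₁.edge ≠ e₂.edge := by
    have hnd := hc'.edges_nodup
    rw [hedges, List.nodup_append] at hnd
    exact hnd.2.2 _ hm₁ _ hm₂
  have hsupp : ∀ e : K.Dart, e.edge ∈ c'.edges → e.fst ∈ c.support ∧ e.snd ∈ c.support := by
    intro e he
    have he' : s(e.fst, e.snd) ∈ c'.edges := he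
    exact ⟨(hsup _).1 (c'.fst_mem_support_of_mem_edges he'),
      (hsup _).1 (c'.snd_mem_support_of_mem_edges he')⟩
  rcases h.leaving_edge e₁.adj hin₁ hout₁ with h₁ | h₁
  · rcases h.leaving_edge e₂.adj hin₂ hout₂ with h₂ | h₂
    · exact absurd (h₁.trans h₂.symm) hne
    · have := hsupp e₂ (by rw [hedges]; exact List.mem_append_right _ hm₂)
      exact ⟨_, _, h₂, this.2, this.1⟩
  · have := hsupp e₁ (by rw [hedges]; exact List.mem_append_left _ hm₁)
    exact ⟨_, _, h₁, this.2, this.1⟩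

end Tree

section Table

variable {V : Type*} [DecidableEq V] {K : SimpleGraph V} {r a b v : V} {T : DFSTable V}

/-- ROOT and ORIEN are determined by the back edge that covers a vertex. -/
lemma DFSTable.IsDFSTableOf.of_covers (hT : T.IsDFSTableOf K r) (hK : IsCactus K)
    (hC : Covers K T.father a b v) :
    T.root v = a ∧ T.father (T.orien v) = a ∧ IsAnc T.father (T.orien v) v ∧ T.orien v ≠ a := by
  have h := hT.dfsTree hK.1
  obtain ⟨c', hc', hs'⟩ := hC.exists_cycle h
  rcases hT.rootOrien v with ⟨hne, o, c, hc, hv, ⟨hρ, hfirst⟩, ⟨hs, hsne, hsf⟩, -⟩ | ⟨-, -, hall⟩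
  · have hvρ : ¬ IsAnc T.father v (T.root v) := fun hanc =>
      hne (h.inj (le_antisymm (hfirst v hv) (h.anc_le hanc)))
    obtain ⟨a', b', hC', ha', hb'⟩ := h.exists_covers hc hv hρ hvρ
    obtain ⟨rfl, rfl⟩ := hC.unique hC' h hK
    have hab := hC.left.trans hC.right
    have heq : c.toSubgraph = c'.toSubgraph := by
      by_contra hne'
      exact hC.adj.ne (hK.2 o a c c' hc hc' hne' a b ha' ((hs' a).2 ⟨IsAnc.refl _ _, hab⟩) hb'
        ((hs' b).2 ⟨hab, IsAnc.refl _ _⟩))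
    have hmem : ∀ z ∈ c.support, IsAnc T.father a z ∧ IsAnc T.father z b := fun z hz => by
      rw [← hs', ← SimpleGraph.Walk.mem_verts_toSubgraph, ← heq,
        SimpleGraph.Walk.mem_verts_toSubgraph]
      exact hz
    have hroot : T.root v = a :=
      h.inj (le_antisymm (hfirst a ha') (h.anc_le (hmem _ hρ).1))
    rw [hroot] at hsne hsf
    refine ⟨hroot, hsf, ?_, hsne⟩
    rcases le_total (T.dfn (T.orien v)) (T.dfn v) with hle | hle
    · exact h.anc_of_le (hmem _ hs).2 hC.right hle
    · have hanc := h.anc_of_le hC.right (hmem _ hs).2 hle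
      by_cases hvs : v = T.orien v
      · rw [← hvs]
        exact IsAnc.refl _ _
      · exact absurd (h.anc_antisymm hC.left (hsf ▸ hanc.of_ne hvs)) hC.ne
  · have hfirst := (hall a c' hc' ((hs' v).2 ⟨hC.left, hC.right⟩)).2 a
      ((hs' a).2 ⟨IsAnc.refl _ _, hC.left.trans hC.right⟩)
    exact absurd (h.inj (le_antisymm (h.anc_le hC.left) hfirst)) hC.ne

lemma DFSTable.IsDFSTableOf.root_eq_self_iff (hT : T.IsDFSTableOf K r) (hK : IsCactus K) :
    T.root v = v ↔ ∀ a b, ¬ Covers K T.father a b v := by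
  have h := hT.dfsTree hK.1
  constructor
  · intro hv a b hC
    exact hC.ne ((hT.of_covers hK hC).1.symm.trans hv)
  · intro hno
    by_contra hne
    rcases hT.rootOrien v with ⟨-, o, c, hc, hv, ⟨hρ, hfirst⟩, -⟩ | ⟨hv, -⟩
    · obtain ⟨a, b, hC, -⟩ := h.exists_covers hc hv hρ fun hanc =>
        hne (h.inj (le_antisymm (hfirst v hv) (h.anc_le hanc)))
      exact hno a b hC
    · exact hne hv

end Table

/-! ### Tables of consecutive vertices -/

section Interval

variable {V : Type*} [DecidableEq V] {T : DFSTable V}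

/-- The vertices with `i ≤ DFN < j`, in the DFS order. -/
def DFSTable.interval (T : DFSTable V) (i j : ℕ) : List V := (T.order.drop i).take (j - i)

lemma DFSTable.exists_dfn_eq (hnd : T.order.Nodup) {n : ℕ} (hn : n < T.order.length) :
    ∃ x, T.dfn x = n :=
  ⟨T.order[n], hnd.idxOf_getElem n hn⟩

lemma DFSTable.mem_interval (hnd : T.order.Nodup) (hall : ∀ x, x ∈ T.order) {i j : ℕ} {x : V} :
    x ∈ T.interval i j ↔ i ≤ T.dfn x ∧ T.dfn x < j := by
  rw [DFSTable.interval, List.mem_iff_getElem]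
  constructor
  · rintro ⟨k, hk, rfl⟩
    have hk' := hk
    rw [List.length_take, List.length_drop] at hk'
    rw [List.getElem_take, List.getElem_drop, DFSTable.dfn, hnd.idxOf_getElem]
    omega
  · rintro ⟨h₁, h₂⟩
    have hlt : T.dfn x < T.order.length := List.idxOf_lt_length_of_mem (hall x)
    refine ⟨T.dfn x - i, ?_, ?_⟩
    · rw [List.length_take, List.length_drop]
      omega
    · rw [List.getElem_take, List.getElem_drop]
      simp only [Nat.add_sub_cancel' h₁]
      exact List.getElem_idxOf hlt

lemma DFSTable.pairwise_interval (hnd : T.order.Nodup) (i j : ℕ) :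
    (T.interval i j).Pairwise (fun a b => T.dfn a < T.dfn b) := by
  have : T.order.Pairwise (fun a b => T.dfn a < T.dfn b) := by
    rw [List.pairwise_iff_getElem]
    intro a b ha hb hab
    rw [DFSTable.dfn, DFSTable.dfn, hnd.idxOf_getElem, hnd.idxOf_getElem]
    exact hab
  exact this.sublist ((List.take_sublist _ _).trans (List.drop_sublist _ _))

lemma lastUnread_eq (hnd : T.order.Nodup) {i j : ℕ} {σ : State V} {x r : V}
    (hx : x ∈ T.interval i j) (hxr : x ∉ σ.read)
    (hmax : ∀ y ∈ T.interval i j, T.dfn x < T.dfn y → y ∈ σ.read) :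
    lastUnread (T.interval i j) r σ = x := by
  have hpw := (T.pairwise_interval hnd i j).filter (fun x => x ∉ σ.read)
  rw [lastUnread]
  set l := (T.interval i j).filter (fun x => x ∉ σ.read) with hl
  have hmem : ∀ y, y ∈ l ↔ y ∈ T.interval i j ∧ y ∉ σ.read := fun y => by simp [hl]
  have hxl : x ∈ l := (hmem x).2 ⟨hx, hxr⟩
  have hne : l ≠ [] := List.ne_nil_of_mem hxl
  rw [List.getLast?_eq_getLast_of_ne_nil hne, Option.getD_some]
  by_contra hxz
  have hsplit := List.dropLast_append_getLast hne
  rw [← hsplit, List.pairwise_append] at hpw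
  rw [← hsplit, List.mem_append, List.mem_singleton] at hxl
  have hlast := (hmem _).1 (List.getLast_mem hne)
  exact hlast.2 (hmax _ hlast.1
    (hpw.2.2 x (hxl.resolve_right fun e => hxz e.symm) _ (List.mem_singleton_self _)))

end Interval

/-! ### The run of the algorithm -/

/-- The vertices with `DFN(u) ≤ DFN < e` form a rooted subcactus with root `u`: they are descendants
of `u`; the descendants of all of them except `u` are included; and the cycles through one of them
other than `u` do not extend above `u`. -/
structure Region {V : Type*} [DecidableEq V] (K : SimpleGraph V) (T : DFSTable V) (u : V) (e : ℕ) :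
    Prop where
  lt : T.dfn u < e
  desc : ∀ x, T.dfn u ≤ T.dfn x → T.dfn x < e → IsAnc T.father u x
  closed : ∀ x y, T.dfn u < T.dfn x → T.dfn x < e → IsAnc T.father x y → T.dfn y < e
  covers : ∀ x a b, T.dfn u < T.dfn x → T.dfn x < e → Covers K T.father a b x → IsAnc T.father u a

section Region

variable {V : Type*} [DecidableEq V] {K : SimpleGraph V} {r u v : V} {T : DFSTable V} {e : ℕ}

/-- The region between a vertex `v` and its father `u`, provided that the cycle of which `u` is a
vertex but not the root, if any, passes through `v`. -/
lemma Region.of_father (h : DFSTree K r T.father T.dfn) (hv : v ≠ r)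
    (hu : T.father v = u) (hcov : ∀ a b, Covers K T.father a b u → IsAnc T.father v b) :
    Region K T u (T.dfn v) := by
  have huv : IsAnc T.father u v := hu ▸ IsAnc.father _ v
  have hlt : T.dfn u < T.dfn v := hu ▸ h.lt v hv
  -- a vertex between `u` and `v` is not an ancestor of `v`
  have hno : ∀ x, T.dfn u < T.dfn x → T.dfn x < T.dfn v → ¬ IsAnc T.father x v := by
    intro x h₁ h₂ hxv
    have := h.anc_le (hxv.of_ne fun e => h₂.ne (by rw [e]))
    rw [hu] at this
    omega
  refine ⟨hlt, fun x h₁ h₂ => h.interval u v x huv h₁ h₂.le, fun x y h₁ h₂ hxy => ?_,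
    fun x a b h₁ h₂ hC => ?_⟩
  · by_contra hle
    exact hno x h₁ h₂ (h.interval x y v hxy h₂.le (not_lt.1 hle))
  · have hux := h.interval u v x huv h₁.le h₂.le
    rcases le_total (T.dfn u) (T.dfn a) with hle | hle
    · exact h.anc_of_le hux hC.left hle
    · by_cases hau : a = u
      · rw [hau]
        exact IsAnc.refl _ _
      · have hb := hcov a b (hC.of_between hau (h.anc_of_le hC.left hux hle) (hux.trans hC.right))
        exact absurd (h.anc_of_le hC.right hb h₂.le) (hno x h₁ h₂)

lemma Region.father_anc (hR : Region K T u e) 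
    (h₁ : T.dfn u < T.dfn v) (h₂ : T.dfn v < e) : IsAnc T.father u (T.father v) :=
  (hR.desc v h₁.le h₂).of_ne fun e => h₁.ne (by rw [e])

end Region

section Run

variable {V : Type*} [Fintype V] [DecidableEq V] {K : SimpleGraph V} {w : V → ℝ} {r : V}
  {T : DFSTable V}

/-- The invariant of the algorithm: the stored values are correct for some partition, and no
cycle has been read in part (the lowest vertex of a cycle is not read before the others). -/
structure Valid (K : SimpleGraph V) (w : V → ℝ) (T : DFSTable V) (σ : State V) : Prop where
  sound : ∃ rep, Sound K w σ rep
  saturated : ∀ a b x, Covers K T.father a b x → b ∈ σ.read → x ∈ σ.read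

/-- `call` behaves like CACTUS on all regions with at most `N` vertices. -/
def CallSpec (K : SimpleGraph V) (w : V → ℝ) (T : DFSTable V)
    (call : V → V → State V → Option (State V)) (N : ℕ) : Prop :=
  ∀ u v σ, Region K T u (T.dfn v) → Valid K w T σ →
    (∀ x, T.dfn u ≤ T.dfn x → T.dfn x < T.dfn v → x ∉ σ.read) → T.dfn v ≤ T.dfn u + N →
    ∃ σ', call u v σ = some σ' ∧ Valid K w T σ' ∧
      ∀ x, x ∈ σ'.read ↔ x ∈ σ.read ∨ (T.dfn u < T.dfn x ∧ T.dfn x < T.dfn v)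

variable {call : V → V → State V → Option (State V)} {N : ℕ} {u : V} {e : ℕ} {R : Finset V}

/-- The loop of CACTUS at a vertex that lies on no cycle below another vertex. Here `R` is the set of
vertices read before the current call. -/
lemma exists_treeLoop (h : DFSTree K r T.father T.dfn)
    (hself : ∀ v, T.root v = v ↔ ∀ a b, ¬ Covers K T.father a b v)
    (hcall : CallSpec K w T call N) (hR : Region K T u e) (hN : e ≤ T.dfn u + N + 1)
    (hRd : ∀ x ∈ R, ¬ (T.dfn u ≤ T.dfn x ∧ T.dfn x < e)) :
    ∀ (k : ℕ) (v : V) (σ : State V), T.dfn v ≤ T.dfn u + k → T.dfn u < T.dfn v → T.dfn v < e →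
      T.root v = v → Valid K w T σ →
      (∀ x, x ∈ σ.read ↔ x ∈ R ∨ (T.dfn v < T.dfn x ∧ T.dfn x < e)) →
      ∃ σ' t, treeLoop T call u k v σ = some σ' ∧ Valid K w T σ' ∧ T.dfn u < t ∧ t ≤ T.dfn v ∧
        ∀ x, x ∈ σ'.read ↔ x ∈ R ∨ (t ≤ T.dfn x ∧ T.dfn x < e)
  | 0, v, σ, hk, huv, _, _, _, _ => by omega
  | k + 1, v, σ, hk, huv, hve, hroot, hσ, hread => by
    have huanc := hR.desc v huv.le hve
    have hvr : v ≠ r := h.ne_root huanc fun e => huv.ne (by rw [e])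
    obtain ⟨p, hp⟩ : ∃ p, T.father v = p := ⟨_, rfl⟩
    have hup : IsAnc T.father u p := hp ▸ hR.father_anc huv hve
    have hple := h.anc_le hup
    have hplt : T.dfn p < T.dfn v := hp ▸ h.lt v hvr
    have hpv : K.Adj p v := hp ▸ h.adj v hvr
    have hnocov := (hself v).1 hroot
    -- the edge join at any state in which the vertices after `v` and some before it are read
    have join : ∀ σ₁ : State V, Valid K w T σ₁ → (∀ x ∈ σ.read, x ∈ σ₁.read) → v ∉ σ₁.read →
        p ∉ σ₁.read → Valid K w T (σ₁.joinEdge p v) := by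
      rintro σ₁ ⟨⟨rep, hs⟩, hsat⟩ hsub hv₁ hp₁
      refine ⟨⟨_, hs.joinEdge hp₁ hv₁ hpv fun y hvy hy => ?_⟩, fun a b x hC hb => ?_⟩
      · rcases lt_trichotomy (T.dfn v) (T.dfn y) with hlt | heq | hlt
        · exact absurd (hsub y ((hread y).2 (Or.inr
            ⟨hlt, hR.closed v y huv hve (h.edge v y hvy hlt)⟩))) hy
        · exact absurd (h.inj heq) hvy.ne
        · by_contra hne
          exact hnocov y v ⟨hvy.symm, fun e => hne (e.trans hp), hvy.symm.ne,
            h.edge y v hvy.symm hlt, IsAnc.refl _ _⟩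
      · simp only [State.joinEdge, Finset.mem_insert] at hb ⊢
        rcases hb with rfl | hb
        · exact absurd (hC.of_between (fun e => hC.adj.ne e) (hC.left.trans hC.right)
            (IsAnc.refl _ _)) (hnocov a b)
        · exact Or.inr (hsat a b x hC hb)
    have hnotR : ∀ x, T.dfn u ≤ T.dfn x → T.dfn x < e → x ∉ R := fun x h₁ h₂ hx =>
      hRd x hx ⟨h₁, h₂⟩
    have hvu : v ∉ σ.read := by
      rw [hread]; rintro (hx | hx); exacts [hnotR v huv.le hve hx, lt_irrefl _ hx.1]
    have hpu : p ∉ σ.read := by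
      rw [hread]; rintro (hx | hx); exacts [hnotR p hple (hplt.trans hve) hx, hplt.not_gt hx.1]
    by_cases hrp : T.root p = p
    · obtain ⟨σ₁, hσ₁, hval₁, hread₁⟩ : ∃ σ₁, (if T.root p = p ∧ T.dfn p < T.dfn v - 1
          then call p v σ else some σ) = some σ₁ ∧ Valid K w T σ₁ ∧
          ∀ x, x ∈ σ₁.read ↔ x ∈ σ.read ∨ (T.dfn p < T.dfn x ∧ T.dfn x < T.dfn v) := by
        split_ifs with hc
        · refine hcall p v σ (Region.of_father h hvr hp fun a b hC =>
            absurd hC ((hself p).1 hrp a b)) hσ (fun x h₁ h₂ => ?_) (by omega)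
          rw [hread]
          rintro (hx | hx)
          · exact hnotR x (hple.trans h₁) (h₂.trans hve) hx
          · omega
        -- without a recursive call, `v` follows its father immediately in the DFS order
        · refine ⟨σ, rfl, hσ, fun x => ⟨Or.inl, ?_⟩⟩
          rintro (hx | hx)
          · exact hx
          · exact absurd ⟨hrp, by omega⟩ hc
      have hv₁ : v ∉ σ₁.read := by
        rw [hread₁]; rintro (hx | hx); exacts [hvu hx, lt_irrefl _ hx.2]
      have hp₁ : p ∉ σ₁.read := by
        rw [hread₁]; rintro (hx | hx); exacts [hpu hx, lt_irrefl _ hx.1]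
      have hval := join σ₁ hval₁ (fun x hx => (hread₁ x).2 (Or.inl hx)) hv₁ hp₁
      have hread₂ : ∀ x, x ∈ (σ₁.joinEdge p v).read ↔
          x ∈ R ∨ (T.dfn p < T.dfn x ∧ T.dfn x < e) := by
        intro x
        have hxv : x = v ↔ T.dfn x = T.dfn v := ⟨fun e => by rw [e], fun e => h.inj e⟩
        simp only [State.joinEdge, Finset.mem_insert, hread₁, hread, hxv]
        constructor
        · rintro (h | (h | h) | h)
          exacts [Or.inr (by omega), Or.inl h, Or.inr (by omega), Or.inr (by omega)]
        · rintro (h | h)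
          · exact Or.inr (Or.inl (Or.inl h))
          · rcases lt_trichotomy (T.dfn x) (T.dfn v) with h' | h' | h'
            exacts [Or.inr (Or.inr ⟨h.1, h'⟩), Or.inl h', Or.inr (Or.inl (Or.inr ⟨h', h.2⟩))]
      rw [treeLoop]
      simp only [hp]
      rw [hσ₁, Option.bind_some]
      by_cases hpu' : p = u
      · rw [if_pos (Or.inr hpu')]
        exact ⟨_, T.dfn u + 1, rfl, hval, by omega, by omega, fun x => by
          rw [hread₂, hpu', Nat.succ_le_iff]⟩
      · rw [if_neg (by simp [hrp, hpu'])]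
        have hup' := h.anc_lt hup (Ne.symm hpu')
        obtain ⟨σ', t, h₁, h₂, h₃, h₄, h₅⟩ := exists_treeLoop h hself hcall hR hN hRd k p
          (σ₁.joinEdge p v) (by omega) hup' (hplt.trans hve) hrp hval hread₂
        exact ⟨σ', t, h₁, h₂, h₃, h₄.trans hplt.le, h₅⟩
    · rw [treeLoop]
      simp only [hp]
      rw [if_neg (fun hc => hrp hc.1), Option.bind_some, if_pos (Or.inl hrp)]
      refine ⟨_, T.dfn v, rfl, join σ hσ (fun _ hx => hx) hvu hpu, huv, le_rfl, fun x => ?_⟩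
      have hxv : x = v ↔ T.dfn x = T.dfn v := ⟨fun e => by rw [e], fun e => h.inj e⟩
      simp only [State.joinEdge, Finset.mem_insert, hread, hxv]
      constructor
      · rintro (h | h | h)
        exacts [Or.inr (by omega), Or.inl h, Or.inr (by omega)]
      · rintro (h | h)
        · exact Or.inr (Or.inl h)
        · rcases h.1.eq_or_lt with h' | h'
          exacts [Or.inl h'.symm, Or.inr (Or.inr ⟨h', h.2⟩)]

/-- The loop of CACTUS along the cycle of the back edge `c b`. It collects the vertices of the cycle
from `v` up to the son of `c`, and reads all vertices of the table below that are not on the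
cycle. -/
lemma exists_cycleLoop (h : DFSTree K r T.father T.dfn) (hK : IsCactus K)
    (hT : T.IsDFSTableOf K r)
    (hcall : CallSpec K w T call N) (hR : Region K T u e) (hN : e ≤ T.dfn u + N + 1)
    (hRd : ∀ x ∈ R, ¬ (T.dfn u ≤ T.dfn x ∧ T.dfn x < e)) {c b : V} (huc : IsAnc T.father u c) :
    ∀ (k : ℕ) (v : V) (σ : State V), T.dfn v ≤ T.dfn u + k → T.dfn v < e →
      Covers K T.father c b v → T.father v ≠ c → Valid K w T σ →
      (∀ x, x ∈ σ.read ↔ x ∈ R ∨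
        (T.dfn v < T.dfn x ∧ T.dfn x < e ∧ ¬ Covers K T.father c b x)) →
      ∃ (σ' : State V) (q : V) (rest : List V), cycleLoop T call k v σ = some (σ', v :: q :: rest) ∧
        Valid K w T σ' ∧ (v :: q :: rest).IsChain (fun x y => y = T.father x) ∧
        (∀ x, x ∈ v :: q :: rest ↔ Covers K T.father c b x ∧ T.dfn x ≤ T.dfn v) ∧
        (v :: q :: rest).Pairwise (fun x y => T.dfn y < T.dfn x) ∧
        T.father ((v :: q :: rest).getLast (by simp)) = c ∧
        ∀ x, x ∈ σ'.read ↔ x ∈ R ∨ (T.dfn ((v :: q :: rest).getLast (by simp)) < T.dfn x ∧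
          T.dfn x < e ∧ ¬ Covers K T.father c b x)
  | 0, v, σ, hk, _, hC, _, _, _ => by
    have := h.anc_le huc
    have := h.anc_lt hC.left hC.ne
    omega
  | k + 1, v, σ, hk, hve, hC, hfv, hσ, hread => by
    have hvr : v ≠ r := h.ne_root hC.left hC.ne
    have hucle := h.anc_le huc
    obtain ⟨p, hp⟩ : ∃ p, T.father v = p := ⟨_, rfl⟩
    have hCp : Covers K T.father c b p := hC.of_between (hp ▸ hfv.symm) (hp ▸ hC.left.of_ne hC.ne)
      (hp ▸ (IsAnc.father _ v).trans hC.right)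
    have hcp := h.anc_lt hCp.left hCp.ne
    have hplt : T.dfn p < T.dfn v := hp ▸ h.lt v hvr
    -- the vertices of the cycle up to `v` are `v` and those up to its father
    have hup : ∀ x, Covers K T.father c b x ∧ T.dfn x ≤ T.dfn v ↔
        x = v ∨ (Covers K T.father c b x ∧ T.dfn x ≤ T.dfn p) := by
      intro x
      constructor
      · rintro ⟨hx, hle⟩
        by_cases hxv : x = v
        · exact Or.inl hxv
        · exact Or.inr ⟨hx, h.anc_le (hp ▸ (h.anc_of_le hx.right hC.right hle).of_ne hxv)⟩
      · rintro (rfl | hx)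
        exacts [⟨hC, le_rfl⟩, ⟨hx.1, hx.2.trans hplt.le⟩]
    have hcov_lt : ∀ x, Covers K T.father c b x → T.dfn x < T.dfn v → T.dfn x ≤ T.dfn p := by
      intro x hx hlt
      rcases (hup x).1 ⟨hx, hlt.le⟩ with rfl | hx
      exacts [absurd hlt (lt_irrefl _), hx.2]
    obtain ⟨σ₁, hσ₁, hval₁, hread₁⟩ : ∃ σ₁, (if T.dfn p < T.dfn v - 1
        then call p v σ else some σ) = some σ₁ ∧ Valid K w T σ₁ ∧
        ∀ x, x ∈ σ₁.read ↔ x ∈ σ.read ∨ (T.dfn p < T.dfn x ∧ T.dfn x < T.dfn v) := by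
      split_ifs with hc
      · refine hcall p v σ (Region.of_father h hvr hp fun a' b' hC' =>
          (hC'.unique hCp h hK).2 ▸ hC.right) hσ (fun x h₁ h₂ => ?_) (by omega)
        rw [hread]
        rintro (hx | hx)
        · exact hRd x hx ⟨by omega, by omega⟩
        · omega
      · refine ⟨σ, rfl, hσ, fun x => ⟨Or.inl, ?_⟩⟩
        rintro (hx | hx)
        · exact hx
        · omega
    have hread₂ : ∀ x, x ∈ σ₁.read ↔ x ∈ R ∨
        (T.dfn p < T.dfn x ∧ T.dfn x < e ∧ ¬ Covers K T.father c b x) := by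
      intro x
      rw [hread₁, hread]
      constructor
      · rintro ((h | h) | h)
        · exact Or.inl h
        · exact Or.inr ⟨hplt.trans h.1, h.2⟩
        · exact Or.inr ⟨h.1, h.2.trans hve, fun hx => (hcov_lt x hx h.2).not_gt h.1⟩
      · rintro (h' | ⟨h₁, h₂, h₃⟩)
        · exact Or.inl (Or.inl h')
        · rcases lt_trichotomy (T.dfn x) (T.dfn v) with h' | h' | h'
          · exact Or.inr ⟨h₁, h'⟩
          · exact absurd (h.inj h' ▸ hC) h₃
          · exact Or.inl (Or.inr ⟨h', h₂, h₃⟩)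
    -- hence `ORIEN(p) = p` holds exactly if the father of `p` is the root `c` of the cycle
    obtain ⟨-, ho₁, ho₂, ho₃⟩ := hT.of_covers hK hCp
    rw [cycleLoop]
    simp only [hp]
    rw [hσ₁, Option.bind_some]
    by_cases hfp : T.father p = c
    · have hpo : p = T.orien p := by
        by_contra hne
        have h₁ := ho₂.of_ne (Ne.symm hne)
        rw [hfp] at h₁
        exact ho₃ (h.anc_antisymm h₁ ⟨1, ho₁⟩)
      rw [if_pos hpo]
      refine ⟨σ₁, p, [], rfl, hval₁, by simp [hp], fun x => ?_, by simpa using hplt,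
        by simpa using hfp, by simpa using hread₂⟩
      rw [hup]
      simp only [List.mem_cons, List.not_mem_nil, or_false]
      refine or_congr_right ⟨?_, ?_⟩
      · rintro rfl
        exact ⟨hCp, le_rfl⟩
      · rintro ⟨hx, hle⟩
        by_contra hxp
        have := (h.anc_of_le hx.right hCp.right hle).of_ne hxp
        rw [hfp] at this
        exact hx.ne (h.anc_antisymm hx.left this)
    · rw [if_neg fun hpo => hfp (by rw [hpo]; exact ho₁)]
      obtain ⟨σ', q, rest, h₁, h₂, h₃, h₄, h₅, h₆, h₇⟩ := exists_cycleLoop h hK hT hcall hR hN hRd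
        huc k p σ₁ (by omega) (hplt.trans hve) hCp hfp hval₁ hread₂
      refine ⟨σ', p, q :: rest, by rw [h₁]; rfl, h₂, ?_, fun x => ?_, ?_, ?_, ?_⟩
      · rw [List.isChain_cons_cons]
        exact ⟨hp.symm, h₃⟩
      · rw [List.mem_cons, h₄, hup]
      · rw [List.pairwise_cons]
        exact ⟨fun x hx => ((h₄ x).1 hx).2.trans_lt hplt, h₅⟩
      · rw [List.getLast_cons (by simp)]
        exact h₆
      · intro x
        rw [List.getLast_cons (by simp)]
        exact h₇ x

/-- The cycle part of CACTUS at the lowest vertex `b` of a cycle with root `c`. -/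
lemma exists_cycleStep (h : DFSTree K r T.father T.dfn) (hK : IsCactus K)
    (hT : T.IsDFSTableOf K r)
    (hcall : CallSpec K w T call N) (hR : Region K T u e) (hN : e ≤ T.dfn u + N + 1)
    (hRd : ∀ x ∈ R, ¬ (T.dfn u ≤ T.dfn x ∧ T.dfn x < e)) {c b : V} {k : ℕ} {σ : State V}
    (hk : T.dfn b ≤ T.dfn u + k) (hub : T.dfn u < T.dfn b) (hbe : T.dfn b < e)
    (hC : Covers K T.father c b b) (hσ : Valid K w T σ)
    (hread : ∀ x, x ∈ σ.read ↔ x ∈ R ∨ (T.dfn b < T.dfn x ∧ T.dfn x < e)) :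
    ∃ σ' t, cycleStep T w call k b σ = some σ' ∧ Valid K w T σ' ∧ T.dfn u < t ∧ t ≤ T.dfn b ∧
      ∀ x, x ∈ σ'.read ↔ x ∈ R ∨ (t ≤ T.dfn x ∧ T.dfn x < e) := by
  have huc : IsAnc T.father u c := hR.covers b c b hub hbe hC
  have hucle := h.anc_le huc
  obtain ⟨σ₁, q, rest, hloop, ⟨⟨rep, hs⟩, hsat⟩, hchain, hmem, hpw, hlast, hread₁⟩ :=
    exists_cycleLoop h hK hT hcall hR hN hRd huc k b σ hk hbe hC hC.ne_father.symm hσ (by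
      intro x
      rw [hread]
      refine or_congr_right ⟨fun hx => ⟨hx.1, hx.2, fun hCx => ?_⟩, fun hx => ⟨hx.1, hx.2.1⟩⟩
      exact (h.anc_le hCx.right).not_gt hx.1)
  obtain ⟨s, hsd⟩ : ∃ s, (b :: q :: rest).getLast (by simp) = s := ⟨_, rfl⟩
  have hsL : s ∈ b :: q :: rest := hsd ▸ List.getLast_mem _
  have hmem' : ∀ x, x ∈ b :: q :: rest ↔ Covers K T.father c b x := fun x => by
    rw [hmem, and_iff_left_iff_imp]
    exact fun hx => h.anc_le hx.right
  rw [hsd] at hlast hread₁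
  have hCs := (hmem' s).1 hsL
  have hcs := h.anc_lt hCs.left hCs.ne
  -- `s` is the highest vertex of the cycle below `c`
  have hs_le : ∀ x, Covers K T.father c b x → T.dfn s ≤ T.dfn x := by
    intro x hx
    by_contra hlt
    have := (h.anc_of_le hx.right hCs.right (not_le.1 hlt).le).of_ne fun e => hlt (by rw [e])
    rw [hlast] at this
    exact hx.ne (h.anc_antisymm hx.left this)
  have hbnd : ∀ x, Covers K T.father c b x → T.dfn u < T.dfn x ∧ T.dfn x < e := fun x hx =>
    ⟨hucle.trans_lt (h.anc_lt hx.left hx.ne), (h.anc_le hx.right).trans_lt hbe⟩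
  have hcread : c ∉ σ₁.read := by
    rw [hread₁]
    rintro (hx | hx)
    · exact hRd c hx ⟨hucle, hcs.trans (hbnd s hCs).2⟩
    · exact hcs.not_gt hx.1
  have hLread : ∀ y, Covers K T.father c b y → y ∉ σ₁.read := by
    intro y hy
    rw [hread₁]
    rintro (hx | hx)
    · exact hRd y hx ⟨(hbnd y hy).1.le, (hbnd y hy).2⟩
    · exact hx.2.2 hy
  have hown : ∀ y, Covers K T.father c b y → ∀ z, K.Adj z y → T.dfn z < T.dfn y →
      z ≠ T.father y → z = c ∧ y = b := fun y hy z hzy hlt hne =>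
    Covers.unique (v := y) ⟨hzy, hne, hzy.ne, h.edge z y hzy hlt, IsAnc.refl _ _⟩ hy h hK
  have hstep := hs.cycle (c := c) (p₁ := b) (p₂ := q) (rest := rest) (nxt := T.father)
    (fun y hy => ⟨hLread y ((hmem' y).1 hy), ((hmem' y).1 hy).ne.symm⟩) hcread
    (hchain.imp_of_mem_imp fun x y hx hy hxy => ⟨hxy, by
      have hCx := (hmem' x).1 hx
      rw [hxy]
      exact h.adj x (h.ne_root hCx.left hCx.ne)⟩)
    (hpw.imp_of_mem fun {x y} hx hy hlt => ⟨fun e => hlt.ne (by rw [e]), fun hxy => by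
      by_contra hne
      exact ((hmem' y).1 hy).ne (hown x ((hmem' x).1 hx) y hxy.symm hlt hne).1.symm⟩)
    hC.adj
    (by rw [hsd, ← hlast]; exact h.adj s (h.ne_root hCs.left hCs.ne))
    (fun y hy hcy => by
      have hCy := (hmem' y).1 hy
      rw [hsd]
      by_cases hf : c = T.father y
      · right
        by_contra hys
        have := (h.anc_of_le hCs.right hCy.right (hs_le y hCy)).of_ne (Ne.symm hys)
        rw [← hf] at this
        exact hCs.ne (h.anc_antisymm hCs.left this)
      · exact Or.inl (hown y hCy c hcy (h.anc_lt hCy.left hCy.ne) hf).2)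
    (fun y hy z hyz hz => by
      have hCy := (hmem' y).1 hy
      rcases lt_trichotomy (T.dfn y) (T.dfn z) with hlt | heq | hlt
      · left
        rw [hmem']
        by_contra hCz
        exact hz ((hread₁ z).2 (Or.inr ⟨(hs_le y hCy).trans_lt hlt,
          hR.closed y z (hbnd y hCy).1 (hbnd y hCy).2 (h.edge y z hyz hlt), hCz⟩))
      · exact absurd (h.inj heq) hyz.ne
      · by_cases hf : z = T.father y
        · by_cases hzc : z = c
          · exact Or.inr hzc
          · left
            rw [hmem']
            exact hCy.of_between (Ne.symm hzc) (hf ▸ hCy.left.of_ne hCy.ne)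
              ((hf ▸ IsAnc.father _ y : IsAnc T.father z y).trans hCy.right)
        · exact Or.inr (hown y hCy z hyz.symm hlt hf).1)
  obtain ⟨pr, hpr, hsound⟩ := hstep
  refine ⟨_, T.dfn s, ?_, ⟨⟨_, hsound⟩, ?_⟩, hucle.trans_lt hcs, hs_le b hC, ?_⟩
  · have hgl : ((b :: q :: rest).getLast?.getD b) = s := by
      rw [List.getLast?_eq_getLast_of_ne_nil (by simp), Option.getD_some, hsd]
    rw [cycleStep, hloop, Option.bind_some]
    simp only [hgl, hlast]
    rw [hpr]
    rfl
  · intro a b' x hCx hb'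
    simp only [Finset.mem_union, List.mem_toFinset, hmem'] at hb' ⊢
    rcases hb' with hb' | hb'
    · exact Or.inl (hsat a b' x hCx hb')
    · have hab' := hCx.left.trans hCx.right
      obtain ⟨rfl, rfl⟩ := (hCx.of_between hCx.adj.ne hab' (IsAnc.refl _ _)).unique hb' h hK
      exact Or.inr hCx
  · intro x
    simp only [Finset.mem_union, List.mem_toFinset, hmem', hread₁]
    constructor
    · rintro ((hx | hx) | hx)
      exacts [Or.inl hx, Or.inr ⟨hx.1.le, hx.2.1⟩, Or.inr ⟨hs_le x hx, (hbnd x hx).2⟩]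
    · rintro (hx | hx)
      · exact Or.inl (Or.inl hx)
      · by_cases hCx : Covers K T.father c b x
        · exact Or.inr hCx
        · refine Or.inl (Or.inr ⟨lt_of_le_of_ne hx.1 fun e => hCx (h.inj e ▸ hCs), hx.2, hCx⟩)

/-- The while loop of CACTUS: the read vertices of the table always form a final segment. -/
lemma exists_whileLoop (hK : IsCactus K) (hT : T.IsDFSTableOf K r)
    (hcall : CallSpec K w T call N) (hR : Region K T u e) (hN : e ≤ T.dfn u + N + 1)
    (he : e ≤ T.order.length)
    (hRd : ∀ x ∈ R, ¬ (T.dfn u ≤ T.dfn x ∧ T.dfn x < e)) :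
    ∀ (k t : ℕ) (σ : State V), t ≤ T.dfn u + k → T.dfn u < t → t ≤ e → Valid K w T σ →
      (∀ x, x ∈ σ.read ↔ x ∈ R ∨ (t ≤ T.dfn x ∧ T.dfn x < e)) →
      ∃ σ', whileLoop T w call (N + 1) (T.interval (T.dfn u) e) u k σ = some σ' ∧ Valid K w T σ' ∧
        ∀ x, x ∈ σ'.read ↔ x ∈ R ∨ (T.dfn u < T.dfn x ∧ T.dfn x < e)
  | 0, t, σ, h₁, h₂, _, _, _ => by omega
  | k + 1, t, σ, hk, hut, hte, hσ, hread => by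
    have h := hT.dfsTree hK.1
    obtain ⟨hnd, hall⟩ := hT.nodup_and_mem hK.1
    obtain ⟨x, hx⟩ := T.exists_dfn_eq hnd (n := t - 1) (by omega)
    have hxr : x ∉ σ.read := by
      rw [hread]
      rintro (hx' | hx')
      · exact hRd x hx' ⟨by omega, by omega⟩
      · omega
    have hlast : lastUnread (T.interval (T.dfn u) e) u σ = x := by
      refine lastUnread_eq hnd ((T.mem_interval hnd hall).2 ⟨by omega, by omega⟩) hxr
        fun y hy hlt => ?_
      rw [T.mem_interval hnd hall] at hy
      exact (hread y).2 (Or.inr ⟨by omega, hy.2⟩)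
    rw [whileLoop]
    simp only [hlast]
    by_cases hxu : x = u
    · rw [if_pos hxu]
      have ht : t = T.dfn u + 1 := by rw [← hxu]; omega
      exact ⟨σ, rfl, hσ, fun y => by rw [hread, ht, Nat.succ_le_iff]⟩
    · rw [if_neg hxu]
      have hux : T.dfn u < T.dfn x := lt_of_le_of_ne (by omega) fun e => hxu (h.inj e).symm
      have hread' : ∀ y, y ∈ σ.read ↔ y ∈ R ∨ (T.dfn x < T.dfn y ∧ T.dfn y < e) := fun y => by
        rw [hread, show t = T.dfn x + 1 by omega, Nat.succ_le_iff]
      obtain ⟨σ', t', h₁, h₂, h₃, h₄, h₅⟩ : ∃ σ' t', (if T.root x = x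
          then treeLoop T call u (N + 1) x σ else cycleStep T w call (N + 1) x σ) = some σ' ∧
          Valid K w T σ' ∧ T.dfn u < t' ∧ t' ≤ T.dfn x ∧
          ∀ y, y ∈ σ'.read ↔ y ∈ R ∨ (t' ≤ T.dfn y ∧ T.dfn y < e) := by
        split_ifs with hroot
        · exact exists_treeLoop h (fun v => hT.root_eq_self_iff hK) hcall hR hN hRd (N + 1) x σ
            (by omega) hux (by omega) hroot hσ hread'
        · rw [hT.root_eq_self_iff hK] at hroot
          push Not at hroot
          obtain ⟨c, b, hC⟩ := hroot
          -- `x` is the lowest vertex of its cycle, since no cycle is read in part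
          have hbx : b = x := by
            by_contra hne
            have hlt := h.anc_lt hC.right (Ne.symm hne)
            exact hxr (hσ.saturated c b x hC ((hread' b).2
              (Or.inr ⟨hlt, hR.closed x b hux (by omega) hC.right⟩)))
          subst hbx
          exact exists_cycleStep h hK hT hcall hR hN hRd (by omega) hux (by omega) hC hσ hread'
      rw [h₁, Option.bind_some]
      exact exists_whileLoop hK hT hcall hR hN he hRd k t' σ' (by omega) h₃ (by omega) h₂ h₅

/-- A call of CACTUS reads all vertices of its table except the root. -/
lemma exists_cactusOn (hK : IsCactus K) (hT : T.IsDFSTableOf K r) :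
    ∀ (n : ℕ) (u : V) (e : ℕ) (σ : State V), Region K T u e → e ≤ T.order.length →
      Valid K w T σ → (∀ x, T.dfn u ≤ T.dfn x → T.dfn x < e → x ∉ σ.read) → e ≤ T.dfn u + n →
      ∃ σ', cactusOn T w n (T.interval (T.dfn u) e) u σ = some σ' ∧ Valid K w T σ' ∧
        ∀ x, x ∈ σ'.read ↔ x ∈ σ.read ∨ (T.dfn u < T.dfn x ∧ T.dfn x < e)
  | 0, u, e, σ, hR, _, _, _, hn => absurd hR.lt (by omega)
  | n + 1, u, e, σ, hR, he, hσ, hun, hn => by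
    have hcall : CallSpec K w T (fun x v τ => cactusOn T w n (T.segment x v) x τ) n :=
      fun u' v' σ' hR' hσ' hun' hn' => exists_cactusOn hK hT n u' (T.dfn v') σ' hR'
        List.idxOf_le_length hσ' hun' hn'
    rw [cactusOn]
    exact exists_whileLoop hK hT hcall hR (by omega) he (fun x hx hx' => hun x hx'.1 hx'.2 hx)
      (n + 1) e σ (by omega) hR.lt le_rfl hσ fun x =>
        ⟨Or.inl, fun hx => hx.resolve_right fun hx' => by omega⟩

/-- CACTUS terminates, and it returns the domination parameters of `K` with root `r`. -/
lemma exists_cactus (hK : IsCactus K) (hT : T.IsDFSTableOf K r) {n : ℕ}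
    (hn : T.order.length ≤ n) :
    ∃ p, cactus T w r n = some p ∧ RootedValues K w Finset.univ ∅ r p := by
  have h := hT.dfsTree hK.1
  obtain ⟨hnd, hall⟩ := hT.nodup_and_mem hK.1
  have hpos : 0 < T.order.length := List.length_pos_of_mem (hall r)
  have hlt : ∀ x, T.dfn x < T.order.length := fun x => List.idxOf_lt_length_of_mem (hall x)
  obtain ⟨x₀, hx₀⟩ := T.exists_dfn_eq hnd hpos
  have hr : T.dfn r = 0 := Nat.le_zero.1 (hx₀ ▸ h.anc_le (h.root_anc x₀))
  have htbl : T.interval (T.dfn r) T.order.length = T.order := by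
    simp [DFSTable.interval, hr]
  obtain ⟨σ, hσ, ⟨⟨rep, hs⟩, -⟩, hread⟩ := exists_cactusOn (w := w) hK hT n r T.order.length
    (initState w)
    ⟨hlt r, fun x _ _ => h.root_anc x, fun _ y _ _ _ => hlt y, fun _ a _ _ _ _ => h.root_anc a⟩
    le_rfl ⟨⟨_, Sound.init⟩, by simp [initState]⟩ (by simp [initState]) (by omega)
  rw [htbl] at hσ
  refine ⟨σ.val r, by rw [cactus, hσ]; rfl, hs.final fun x => ?_⟩
  rw [hread]
  simp only [initState, Finset.notMem_empty, false_or, hr, hlt x, and_true, not_lt, Nat.le_zero]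
  rw [← hr]
  exact h.inj.eq_iff

end Run

end CactusDomination

theorem mainTheorem2 {V : Type*} [Fintype V] [DecidableEq V]
    (K : SimpleGraph V) (hK : CactusDomination.IsCactus K)
    (w : V → ℝ) (hw : ∀ v, 0 < w v) (r : V)
    (T : CactusDomination.DFSTable V) (hT : T.IsDFSTableOf K r) :
    ∃ (N : ℕ) (p : CactusDomination.Params),
      (∀ n, N ≤ n → CactusDomination.cactus T w r n = some p) ∧
      p.g = CactusDomination.gammaW K w ∧
      p.g00 = CactusDomination.gamma00 K w r ∧
      p.g1 = CactusDomination.gamma1 K w r ∧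
      p.g0 = CactusDomination.gamma0 K w r := by
  obtain ⟨p, -, hp⟩ := CactusDomination.exists_cactus (w := w) hK hT le_rfl
  refine ⟨T.order.length, p, fun n hn => ?_, hp.eq_gammaW, hp.eq_gamma00, hp.eq_gamma1,
    hp.eq_gamma0⟩
  -- the correct values are unique, so that the result does not depend on the bound
  obtain ⟨q, hq, hqv⟩ := CactusDomination.exists_cactus (w := w) hK hT hn
  rw [hq, hqv.unique hp]
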